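/- Let $p>2$ be a prime, $k=\mathbb F_p$, $G=SL_2$, and $X=\mathbb P^1_k=\operatorname{Proj} k[x_0,x_1]$, where $k[x_0,x_1]=\operatorname{Sym}V$ for the standard representation $V$ of $G$ with basis $x_0,x_1$. Let $\mathcal D_X=\bigcup_n\mathcal D_X^{n}$ be the sheaf of $k$-linear differential operators filtered by the order, and let $\operatorname{Dist}(G)=\bigcup_n\operatorname{Dist}(G)_n$ be the algebra of distributions of $G$ filtered by the order. For $m\ge 0$ let $$\mathcal D_X^{(m)}=\mathbb T_k(\mathcal D_X^{2p^m-1})/(\lambda-\lambda 1,\ D\otimes D'-D'\otimes D-[D,D'],\ D\otimes D''-DD''),$$ with $\lambda\in k$, $D,D'\in\mathcal D_X^{p^m}$, $D''\in\mathcal D_X^{p^m-1}$, as a sheaf of algebras, and define $U^{(m)}$ in the same way from $\operatorname{Dist}(G)$. Let $\rho_m:U^{(m)}\to H^0(X,\mathcal D_X^{(m)})$ be induced by the canonical morphism $\rho:\operatorname{Dist}(G)\to H^0(X,\mathcal D_X)$ given by the action of $G$ on $V$. Let $H=\operatorname{diag}(1,-1)\in\operatorname{Lie}(G)\subset\operatorname{Dist}(G)$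 and $$\Delta_T=\sum_{i=0}^{p-1}(-1)^i\binom{H}{i},\qquad \binom Hi=\frac{H(H-1)\cdots(H-i+1)}{i!},$$ and write $\Delta_T$ also for its image in $U^{(m)}$ for $m>0$. There is a unique global differential operator $\mathcal H\in H^0(X,\mathcal D_X^{p-1})$ (the Dwork operator, or Garnier's projector) such that, on each of the two standard affine charts, with coordinate $t=x_1/x_0$, resp. $t=x_0/x_1$, $\mathcal H$ is the reduction modulo $p$ of $f\mapsto F^*(\operatorname{Tr}_F(f)/p)$, where $F:t\mapsto t^p$ is the lift to $\mathbb Z_p$ of the Frobenius of $X$ given by $[x_0:x_1]\mapsto[x_0^p:x_1^p]$. On each of these charts $$\mathcal H=\sum_{r=0}^{p-1}(-t)^r\,\partial_t^{[r]},$$ and for every $m>0$ one has $$\rho_m(\Delta_T)=\mathcal H\quad\text{in } H^0(X,\mathcal D_X^{(m)}).$$ -/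

import Mathlib

noncomputable section

open CategoryTheory AlgebraicGeometry TopologicalSpace Opposite
open scoped TensorProduct Polynomial

namespace ArithDiff

/-! ### Level `m` algebras attached to a filtered algebra -/

section Level

variable {k B C D : Type} [CommRing k] [Ring B] [Algebra k B] [Ring C] [Algebra k C]
  [Ring D] [Algebra k D]

/-- The relations on the tensor algebra of `Fil (2q - 1)` which define the algebra of level `m`,
with `q = p ^ m`: `λ = λ·1` for scalars, `x ⊗ y - y ⊗ x = [x, y]` for `x, y ∈ Fil q`, and
`x ⊗ y = x y` for `x ∈ Fil q`, `y ∈ Fil (q - 1)`. -/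
inductive LevelRel (q : ℕ) (Fil : ℕ → Submodule k B) :
    TensorAlgebra k (Fil (2 * q - 1)) → TensorAlgebra k (Fil (2 * q - 1)) → Prop
  | scalar (c : k) (x : Fil (2 * q - 1)) (hx : (x : B) = algebraMap k B c) :
      LevelRel q Fil (algebraMap k _ c) (TensorAlgebra.ι k x)
  | comm (x y z : Fil (2 * q - 1)) (hx : (x : B) ∈ Fil q) (hy : (y : B) ∈ Fil q)
      (hz : (z : B) = x * y - y * x) :
      LevelRel q Fil
        (TensorAlgebra.ι k x * TensorAlgebra.ι k y - TensorAlgebra.ι k y * TensorAlgebra.ι k x)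
        (TensorAlgebra.ι k z)
  | mul (x y z : Fil (2 * q - 1)) (hx : (x : B) ∈ Fil q) (hy : (y : B) ∈ Fil (q - 1))
      (hz : (z : B) = x * y) :
      LevelRel q Fil (TensorAlgebra.ι k x * TensorAlgebra.ι k y) (TensorAlgebra.ι k z)

/-- The algebra of level `m` (with `q = p ^ m`) attached to an algebra `B` with an increasing
filtration `Fil`: the quotient of the tensor algebra of `Fil (2q - 1)` by the relations
`LevelRel`. -/
def LevelAlg (q : ℕ) (Fil : ℕ → Submodule k B) : Type := RingQuot (LevelRel q Fil)

instance (q : ℕ) (Fil : ℕ → Submodule k B) : Ring (LevelAlg q Fil) :=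
  inferInstanceAs (Ring (RingQuot (LevelRel q Fil)))

instance (q : ℕ) (Fil : ℕ → Submodule k B) : Algebra k (LevelAlg q Fil) :=
  inferInstanceAs (Algebra k (RingQuot (LevelRel q Fil)))

/-- The canonical map from `Fil (2q - 1)` to the algebra of level `m`. -/
def LevelAlg.of (q : ℕ) (Fil : ℕ → Submodule k B) : Fil (2 * q - 1) →ₗ[k] LevelAlg q Fil :=
  (RingQuot.mkAlgHom k (LevelRel q Fil)).toLinearMap ∘ₗ TensorAlgebra.ι k

theorem LevelAlg.hom_ext {q : ℕ} {Fil : ℕ → Submodule k B} {f g : LevelAlg q Fil →ₐ[k] C}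
    (h : ∀ x, f (LevelAlg.of q Fil x) = g (LevelAlg.of q Fil x)) : f = g := by
  apply RingQuot.ringQuot_ext'
  apply TensorAlgebra.hom_ext
  ext x
  exact h x

/-- Functoriality of the algebra of level `m` for morphisms of filtered algebras. -/
def LevelAlg.map (q : ℕ) {Fil : ℕ → Submodule k B} {Fil' : ℕ → Submodule k C} (φ : B →ₐ[k] C)
    (hφ : ∀ n, ∀ x ∈ Fil n, φ x ∈ Fil' n) : LevelAlg q Fil →ₐ[k] LevelAlg q Fil' :=
  RingQuot.liftAlgHom k
    ⟨TensorAlgebra.lift k (LevelAlg.of q Fil' ∘ₗ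
      (φ.toLinearMap.restrict (p := Fil (2 * q - 1)) (q := Fil' (2 * q - 1)) (hφ _))), by
      rintro _ _ (⟨c, x, hx⟩ | ⟨x, y, z, hx, hy, hz⟩ | ⟨x, y, z, hx, hy, hz⟩)
      · rw [AlgHom.commutes, TensorAlgebra.lift_ι_apply]
        have := RingQuot.mkAlgHom_rel k (LevelRel.scalar (q := q) (Fil := Fil') c
          ⟨φ x, hφ _ _ x.2⟩ (by simp [hx]))
        rw [AlgHom.commutes] at this
        exact this
      · simp only [map_sub, map_mul, TensorAlgebra.lift_ι_apply]
        have := RingQuot.mkAlgHom_rel k (LevelRel.comm (q := q) (Fil := Fil')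
          ⟨φ x, hφ _ _ x.2⟩ ⟨φ y, hφ _ _ y.2⟩ ⟨φ z, hφ _ _ z.2⟩ (hφ _ _ hx) (hφ _ _ hy)
          (by simp [hz]))
        simp only [map_sub, map_mul] at this
        exact this
      · simp only [map_mul, TensorAlgebra.lift_ι_apply]
        have := RingQuot.mkAlgHom_rel k (LevelRel.mul (q := q) (Fil := Fil')
          ⟨φ x, hφ _ _ x.2⟩ ⟨φ y, hφ _ _ y.2⟩ ⟨φ z, hφ _ _ z.2⟩ (hφ _ _ hx) (hφ _ _ hy)
          (by simp [hz]))
        simp only [map_mul] at this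
        exact this⟩

theorem LevelAlg.map_of (q : ℕ) {Fil : ℕ → Submodule k B} {Fil' : ℕ → Submodule k C}
    (φ : B →ₐ[k] C) (hφ : ∀ n, ∀ x ∈ Fil n, φ x ∈ Fil' n) (x : Fil (2 * q - 1)) :
    LevelAlg.map q φ hφ (LevelAlg.of q Fil x) = LevelAlg.of q Fil' ⟨φ x, hφ _ _ x.2⟩ := by
  change RingQuot.liftAlgHom k _ (RingQuot.mkAlgHom k _ _) = _
  rw [RingQuot.liftAlgHom_mkAlgHom_apply, TensorAlgebra.lift_ι_apply]
  rfl

end Level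

/-! ### Differential operators -/

section DiffOp

variable {k A : Type} [CommRing k] [CommRing A] [Algebra k A]

/-- The `k`-linear differential operators of order `< n` of a commutative `k`-algebra `A`. -/
def diffOpLT (k A : Type) [CommRing k] [CommRing A] [Algebra k A] :
    ℕ → Submodule k (Module.End k A)
  | 0 => ⊥
  | n + 1 =>
    { carrier := {P | ∀ a : A, P * LinearMap.mulLeft k a - LinearMap.mulLeft k a * P ∈
        diffOpLT k A n}
      zero_mem' := fun a => by simp
      add_mem' := fun {P Q} hP hQ a => by
        have := add_mem (hP a) (hQ a)
        rwa [show P * LinearMap.mulLeft k a - LinearMap.mulLeft k a * P +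
          (Q * LinearMap.mulLeft k a - LinearMap.mulLeft k a * Q) =
          (P + Q) * LinearMap.mulLeft k a - LinearMap.mulLeft k a * (P + Q) by
            rw [add_mul, mul_add]; abel] at this
      smul_mem' := fun c P hP a => by
        have := Submodule.smul_mem _ c (hP a)
        rwa [smul_sub, ← smul_mul_assoc, ← mul_smul_comm] at this }

/-- The `k`-linear differential operators of order `≤ n` of `A`. -/
def diffOp (k A : Type) [CommRing k] [CommRing A] [Algebra k A] (n : ℕ) :
    Submodule k (Module.End k A) := diffOpLT k A (n + 1)

theorem mem_diffOpLT_succ {n : ℕ} {P : Module.End k A} : P ∈ diffOpLT k A (n + 1) ↔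
    ∀ a : A, P * LinearMap.mulLeft k a - LinearMap.mulLeft k a * P ∈ diffOpLT k A n := Iff.rfl

theorem diffOpLT_mono_succ (n : ℕ) : diffOpLT k A n ≤ diffOpLT k A (n + 1) := by
  induction n with
  | zero => exact bot_le
  | succ n ih => exact fun P hP a => ih (hP a)

theorem diffOpLT_mono : Monotone (diffOpLT k A) := monotone_nat_of_le_succ diffOpLT_mono_succ

theorem mul_mem_diffOpLT : ∀ (s a b : ℕ), a + b = s → ∀ {P Q : Module.End k A},
    P ∈ diffOpLT k A a → Q ∈ diffOpLT k A b → P * Q ∈ diffOpLT k A (a + b - 1) := by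
  intro s
  induction s with
  | zero =>
    intro a b h P Q hP hQ
    obtain rfl : a = 0 := by omega
    rw [show P = 0 from hP, zero_mul]
    exact zero_mem _
  | succ s ih =>
    intro a b h P Q hP hQ
    match a, b with
    | 0, b => rw [show P = 0 from hP, zero_mul]; exact zero_mem _
    | a + 1, 0 => rw [show Q = 0 from hQ, mul_zero]; exact zero_mem _
    | a + 1, b + 1 =>
      rw [show a + 1 + (b + 1) - 1 = (a + b) + 1 by omega]
      intro f
      have h1 := ih (a + 1) b (by omega) hP (hQ f)
      have h2 := ih a (b + 1) (by omega) (hP f) hQ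
      rw [show a + 1 + b - 1 = a + b by omega] at h1
      rw [show a + (b + 1) - 1 = a + b by omega] at h2
      have := add_mem h1 h2
      convert! this using 1
      simp only [mul_sub, sub_mul, mul_assoc]
      abel

/-- A functional on a thickening gives a differential operator. -/
theorem comp_mem_diffOpLT {R : Type} [CommRing R] [Algebra k R] [Algebra A R]
    [IsScalarTower k A R] (J : Ideal R) (β : A →ₐ[k] R)
    (hβ : ∀ a, β a - algebraMap A R a ∈ J) (n : ℕ) :
    ∀ (Φ : R →ₗ[A] A), (∀ r ∈ J ^ n, Φ r = 0) →
      (Φ.restrictScalars k ∘ₗ β.toLinearMap) ∈ diffOpLT k A n := by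
  induction n with
  | zero =>
    intro Φ hΦ
    change _ = _
    ext a
    exact hΦ _ (by simp)
  | succ n ih =>
    intro Φ hΦ a
    have := ih (Φ ∘ₗ LinearMap.mulLeft A (β a - algebraMap A R a)) (fun r hr => by
      apply hΦ
      rw [pow_succ']
      exact Ideal.mul_mem_mul (hβ a) hr)
    convert! this using 1
    ext b
    simp [sub_mul, ← Algebra.smul_def]

/-- Differential operators can be tested through a jointly injective family of ring
homomorphisms. -/
theorem mem_diffOpLT_of_injective {ι : Type} {L : Type} [CommRing L] [Algebra k L]
    (θ : ι → A →+* L) (hθ : ∀ a, (∀ i, θ i a = 0) → a = 0) (n : ℕ) :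
    ∀ (Q : Module.End k A) (P : ι → Module.End k L), (∀ i, P i ∈ diffOpLT k L n) →
      (∀ i a, θ i (Q a) = P i (θ i a)) → Q ∈ diffOpLT k A n := by
  induction n with
  | zero =>
    intro Q P hP h
    change _ = _
    ext a
    refine hθ _ fun i => ?_
    rw [h, show P i = 0 from hP i]
    rfl
  | succ n ih =>
    intro Q P hP h a
    refine ih _ (fun i => P i * LinearMap.mulLeft k (θ i a) - LinearMap.mulLeft k (θ i a) * P i)
      (fun i => hP i _) fun i b => ?_
    simp [h]

end DiffOp

/-! ### The sheaf of differential operators and its variants of level `m` -/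

section Sheaf

variable {X : Scheme.{0}} {k : Type} [CommRing k] (f : X ⟶ Spec (.of k))

theorem le_preimage_top (U : X.Opens) : U ≤ f ⁻¹ᵁ ⊤ := fun _ _ => trivial

/-- Sections of the structure sheaf of the `k`-scheme `X`, as a `k`-algebra. -/
def Sec (_ : X ⟶ Spec (.of k)) (U : X.Opens) : Type := Γ(X, U)

instance (U : X.Opens) : CommRing (Sec f U) := inferInstanceAs (CommRing Γ(X, U))

instance (U : X.Opens) : Algebra k (Sec f U) :=
  RingHom.toAlgebra (S := Sec f U) ((Scheme.ΓSpecIso (.of k)).inv ≫ f.appLE ⊤ U (le_preimage_top f U)).hom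

/-- Restriction of sections. -/
def Sec.res {U V : X.Opens} (h : V ≤ U) : Sec f U →ₐ[k] Sec f V where
  toRingHom := (X.presheaf.map (homOfLE h).op).hom
  commutes' c := by
    change (((Scheme.ΓSpecIso (.of k)).inv ≫ f.appLE ⊤ U (le_preimage_top f U)) ≫
      X.presheaf.map (homOfLE h).op).hom c =
      ((Scheme.ΓSpecIso (.of k)).inv ≫ f.appLE ⊤ V (le_preimage_top f V)).hom c
    rw [Category.assoc, Scheme.Hom.appLE_map]

/-- The `k`-linear endomorphisms of the sheaf `O_X` restricted to the open set `U`: compatible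
families of `k`-linear endomorphisms of `O_X(V)`, for `V ⊆ U` open. -/
def sheafEnd (U : X.Opens) :
    Subalgebra k (∀ V : {V : X.Opens // V ≤ U}, Module.End k (Sec f V.1)) where
  carrier := {P | ∀ (V W : {V : X.Opens // V ≤ U}) (h : V.1 ≤ W.1) (s : Sec f W.1),
    Sec.res f h (P W s) = P V (Sec.res f h s)}
  mul_mem' {P Q} hP hQ V W h s := by
    simp only [Pi.mul_apply, Module.End.mul_apply]
    rw [hP V W h, hQ V W h]
  add_mem' {P Q} hP hQ V W h s := by
    simp only [Pi.add_apply, LinearMap.add_apply, map_add]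
    rw [hP V W h, hQ V W h]
  algebraMap_mem' c V W h s := by
    simp [Pi.algebraMap_apply, Module.algebraMap_end_apply]

instance (U : X.Opens) : Ring (sheafEnd f U) := Subalgebra.toRing _

instance (U : X.Opens) : Algebra k (sheafEnd f U) := Subalgebra.algebra _

/-- Differential operators of order `≤ n` on the open set `U`, relative to `k`. -/
def diffOps (n : ℕ) (U : X.Opens) : Submodule k (sheafEnd f U) where
  carrier := {P | ∀ V, P.1 V ∈ diffOp k (Sec f V.1) n}
  zero_mem' _ := zero_mem _
  add_mem' hP hQ V := add_mem (hP V) (hQ V)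
  smul_mem' c _ hP V := Submodule.smul_mem _ c (hP V)

/-- Restriction of endomorphisms of the structure sheaf. -/
def sheafEndRes {U U' : X.Opens} (h : U' ≤ U) : sheafEnd f U →ₐ[k] sheafEnd f U' where
  toFun P := ⟨fun V => P.1 ⟨V.1, V.2.trans h⟩, fun V W hVW s =>
    P.2 ⟨V.1, V.2.trans h⟩ ⟨W.1, W.2.trans h⟩ hVW s⟩
  map_one' := rfl
  map_mul' _ _ := rfl
  map_zero' := rfl
  map_add' _ _ := rfl
  commutes' _ := rfl

theorem sheafEndRes_mem {U U' : X.Opens} (h : U' ≤ U) (n : ℕ) (P : sheafEnd f U)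
    (hP : P ∈ diffOps f n U) : sheafEndRes f h P ∈ diffOps f n U' := fun V =>
  hP ⟨V.1, V.2.trans h⟩

/-- The presheaf of algebras `U ↦ T_k(D^{2q-1}(U)) / relations`, on objects (`q = p ^ m`). -/
abbrev LevelSec (q : ℕ) (U : X.Opens) : Type := LevelAlg q fun n => diffOps f n U

/-- The presheaf of algebras `U ↦ T_k(D^{2q-1}(U)) / relations`, on morphisms (`q = p ^ m`). -/
def levelRes (q : ℕ) {U U' : X.Opens} (h : U' ≤ U) : LevelSec f q U →ₐ[k] LevelSec f q U' :=
  LevelAlg.map q (sheafEndRes f h) (sheafEndRes_mem f h)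

theorem levelRes_id (q : ℕ) (U : X.Opens) : levelRes f q (le_refl U) = AlgHom.id k _ := by
  apply LevelAlg.hom_ext
  intro x
  exact LevelAlg.map_of ..

theorem levelRes_comp (q : ℕ) {U U' U'' : X.Opens} (h : U' ≤ U) (h' : U'' ≤ U') :
    levelRes f q (h'.trans h) = (levelRes f q h').comp (levelRes f q h) := by
  apply LevelAlg.hom_ext
  intro x
  simp only [AlgHom.comp_apply, levelRes]
  rw [LevelAlg.map_of, LevelAlg.map_of, LevelAlg.map_of]
  rfl

/-- The presheaf of algebras `U ↦ T_k(D^{2q-1}(U)) / relations`, with `q = p ^ m`. -/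
def levelPresheaf (q : ℕ) : X.Opensᵒᵖ ⥤ AlgCat.{0} k where
  obj U := AlgCat.of k (LevelSec f q U.unop)
  map i := AlgCat.ofHom (levelRes f q i.unop.le)
  map_id U := congrArg AlgCat.ofHom (levelRes_id f q U.unop)
  map_comp i j := congrArg AlgCat.ofHom (levelRes_comp f q i.unop.le j.unop.le)

/-- The sheaf `D_X^{(m)}` of differential operators of level `m` (`q = p ^ m`). -/
def levelSheaf (q : ℕ) : Sheaf (Opens.grothendieckTopology X) (AlgCat.{0} k) :=
  (presheafToSheaf (Opens.grothendieckTopology X) (AlgCat.{0} k)).obj (levelPresheaf f q)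

/-- The algebra `H⁰(X, D_X^{(m)})` of global sections (`q = p ^ m`). -/
abbrev levelGlobal (q : ℕ) : AlgCat.{0} k := (levelSheaf f q).obj.obj (op ⊤)

/-- The canonical map to `H⁰(X, D_X^{(m)})` from the global sections of the presheaf. -/
def levelToGlobal (q : ℕ) : LevelSec f q ⊤ →ₐ[k]
    levelGlobal f q :=
  ((toSheafify (Opens.grothendieckTopology X) (levelPresheaf f q)).app (op ⊤)).hom

end Sheaf

/-! ### Distributions -/

section Dist

variable (k C : Type) [CommRing k] [CommRing C] [Bialgebra k C]

/-- The augmentation ideal of a bialgebra: the ideal of the unit element of the corresponding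
group scheme. -/
def augIdeal : Ideal C := RingHom.ker (Bialgebra.counitAlgHom k C)

/-- The distributions of order `≤ n` at the unit element: linear forms which vanish on the
`(n + 1)`-st power of the augmentation ideal. -/
def distLE (n : ℕ) : Submodule k (WithConv (C →ₗ[k] k)) where
  carrier := {μ | ∀ c ∈ augIdeal k C ^ (n + 1), μ c = 0}
  zero_mem' _ _ := rfl
  add_mem' {μ ν} hμ hν c hc := by
    change μ c + ν c = 0
    rw [hμ c hc, hν c hc, add_zero]
  smul_mem' a μ hμ c hc := by
    change a • μ c = 0
    rw [hμ c hc, smul_zero]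

variable {k C}

theorem distLE_mono : Monotone (distLE k C) := fun _ _ h _ hμ c hc =>
  hμ c (Ideal.pow_le_pow_right (by omega) hc)

theorem comul_augIdeal (c : C) (hc : c ∈ augIdeal k C) :
    Bialgebra.comulAlgHom k C c ∈
      (augIdeal k C).map (Algebra.TensorProduct.includeLeft : C →ₐ[k] C ⊗[k] C) ⊔
      (augIdeal k C).map (Algebra.TensorProduct.includeRight : C →ₐ[k] C ⊗[k] C) := by
  set K := (augIdeal k C).map (Algebra.TensorProduct.includeLeft : C →ₐ[k] C ⊗[k] C) ⊔
      (augIdeal k C).map (Algebra.TensorProduct.includeRight : C →ₐ[k] C ⊗[k] C) with hK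
  have key : ∀ x : C ⊗[k] C, x - algebraMap k (C ⊗[k] C) (TensorProduct.lid k k
      (TensorProduct.map (Coalgebra.counit (R := k)) (Coalgebra.counit (R := k)) x)) ∈ K := by
    intro x
    induction x with
    | zero => simp
    | add x y hx hy =>
      simp only [map_add]
      convert! add_mem hx hy using 1
      ring
    | tmul a b =>
      have h1 : ∀ a : C, a - algebraMap k C (Coalgebra.counit (R := k) a) ∈ augIdeal k C :=
        fun a => by
          change Bialgebra.counitAlgHom k C _ = 0
          rw [map_sub, AlgHom.commutes]
          simp
      have h2 : (a - algebraMap k C (Coalgebra.counit (R := k) a)) ⊗ₜ[k] b ∈ K := by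
        have := Ideal.mul_mem_right (1 ⊗ₜ[k] b) K (Ideal.mem_sup_left (Ideal.mem_map_of_mem
          (Algebra.TensorProduct.includeLeft : C →ₐ[k] C ⊗[k] C) (h1 a)))
        simpa using this
      have h3 : algebraMap k C (Coalgebra.counit (R := k) a) ⊗ₜ[k]
          (b - algebraMap k C (Coalgebra.counit (R := k) b)) ∈ K := by
        have := Ideal.mul_mem_left K (algebraMap k C (Coalgebra.counit (R := k) a) ⊗ₜ[k] 1)
          (Ideal.mem_sup_right (Ideal.mem_map_of_mem
          (Algebra.TensorProduct.includeRight : C →ₐ[k] C ⊗[k] C) (h1 b)))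
        simpa using this
      convert! add_mem h2 h3 using 1
      simp only [TensorProduct.map_tmul, TensorProduct.lid_tmul, TensorProduct.sub_tmul,
        TensorProduct.tmul_sub, smul_eq_mul, map_mul]
      have e : ∀ r s : k, algebraMap k C r ⊗ₜ[k] algebraMap k C s =
          algebraMap k (C ⊗[k] C) r * algebraMap k (C ⊗[k] C) s := fun r s => by
        rw [Algebra.TensorProduct.algebraMap_apply]
        simp [Algebra.algebraMap_eq_smul_one, TensorProduct.smul_tmul]
      rw [e]
      ring
  have := key (Bialgebra.comulAlgHom k C c)
  have h0 : TensorProduct.lid k k (TensorProduct.map (Coalgebra.counit (R := k))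
      (Coalgebra.counit (R := k)) (Bialgebra.comulAlgHom k C c)) = 0 := by
    have e : (TensorProduct.map (Coalgebra.counit (R := k)) (Coalgebra.counit (R := k)) :
        C ⊗[k] C →ₗ[k] k ⊗[k] k) = (LinearMap.lTensor k (Coalgebra.counit (R := k))) ∘ₗ
          (LinearMap.rTensor C (Coalgebra.counit (R := k))) := by
      ext; simp
    rw [e, LinearMap.comp_apply, Bialgebra.comulAlgHom_apply,
      Coalgebra.rTensor_counit_comul]
    have : Coalgebra.counit (R := k) c = 0 := hc
    simp [this]
  rwa [h0, map_zero, sub_zero] at this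

theorem map_ideal_eq_zero {R S M : Type} [CommRing R] [CommRing S] [AddCommGroup M] (φ : R →+* S)
    (I : Ideal R) (Ψ : S →+ M) (h : ∀ s, ∀ i ∈ I, Ψ (s * φ i) = 0) (x : S) (hx : x ∈ I.map φ) :
    Ψ x = 0 := by
  suffices ∀ s, Ψ (s * x) = 0 by simpa using this 1
  refine Submodule.span_induction (p := fun x _ => ∀ s, Ψ (s * x) = 0) ?_ ?_ ?_ ?_ hx
  · rintro _ ⟨i, hi, rfl⟩ s
    exact h s i hi
  · simp
  · intro x y _ _ hx hy s
    rw [mul_add, map_add, hx, hy, add_zero]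
  · intro a x _ hx s
    rw [smul_eq_mul, ← mul_assoc]
    exact hx _

theorem convMul_mem {n m : ℕ} {μ ν : WithConv (C →ₗ[k] k)} (hμ : μ ∈ distLE k C n)
    (hν : ν ∈ distLE k C m) : μ * ν ∈ distLE k C (n + m + 1) := by
  intro c hc
  rw [LinearMap.convMul_apply]
  have h1 : Bialgebra.comulAlgHom k C c ∈ ((augIdeal k C).map
        (Algebra.TensorProduct.includeLeft : C →ₐ[k] C ⊗[k] C) ⊔ (augIdeal k C).map
        (Algebra.TensorProduct.includeRight : C →ₐ[k] C ⊗[k] C)) ^ ((n + 1) + (m + 1)) := by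
    have h2 : (augIdeal k C).map (Bialgebra.comulAlgHom k C) ≤ (augIdeal k C).map
        (Algebra.TensorProduct.includeLeft : C →ₐ[k] C ⊗[k] C) ⊔ (augIdeal k C).map
        (Algebra.TensorProduct.includeRight : C →ₐ[k] C ⊗[k] C) := by
      rw [Ideal.map_le_iff_le_comap]
      exact fun c hc => comul_augIdeal c hc
    refine Ideal.pow_right_mono h2 _ ?_
    rw [← Ideal.map_pow]
    refine Ideal.mem_map_of_mem _ ?_
    rwa [show n + 1 + (m + 1) = n + m + 1 + 1 by omega]
  have h2 := Ideal.sup_pow_add_le_pow_sup_pow h1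
  rw [← Ideal.map_pow, ← Ideal.map_pow] at h2
  obtain ⟨y, hy, z, hz, hyz⟩ := Submodule.mem_sup.mp h2
  rw [Bialgebra.comulAlgHom_apply] at hyz
  rw [← hyz]
  let Ψ : C ⊗[k] C →ₗ[k] k := LinearMap.mul' k k ∘ₗ TensorProduct.map μ.ofConv ν.ofConv
  change Ψ (y + z) = 0
  have hy' := map_ideal_eq_zero
    ((Algebra.TensorProduct.includeLeft : C →ₐ[k] C ⊗[k] C) : C →+* C ⊗[k] C) _
    Ψ.toAddMonoidHom (fun s i hi => by
      change Ψ (s * (i ⊗ₜ 1)) = 0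
      induction s with
      | zero => simp
      | add s t hs ht => rw [add_mul, map_add, hs, ht, add_zero]
      | tmul a b =>
        rw [Algebra.TensorProduct.tmul_mul_tmul]
        change μ.ofConv (a * i) * ν.ofConv (b * 1) = 0
        rw [show μ.ofConv (a * i) = 0 from hμ _ (Ideal.mul_mem_left _ _ hi), zero_mul]) y hy
  have hz' := map_ideal_eq_zero
    ((Algebra.TensorProduct.includeRight : C →ₐ[k] C ⊗[k] C) : C →+* C ⊗[k] C) _
    Ψ.toAddMonoidHom (fun s i hi => by
      change Ψ (s * (1 ⊗ₜ i)) = 0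
      induction s with
      | zero => simp
      | add s t hs ht => rw [add_mul, map_add, hs, ht, add_zero]
      | tmul a b =>
        rw [Algebra.TensorProduct.tmul_mul_tmul]
        change μ.ofConv (a * 1) * ν.ofConv (b * i) = 0
        rw [show ν.ofConv (b * i) = 0 from hν _ (Ideal.mul_mem_left _ _ hi), mul_zero]) z hz
  rw [map_add]
  exact (congrArg₂ (· + ·) hy' hz').trans (add_zero 0)

theorem algebraMap_mem_distLE (a : k) :
    algebraMap k (WithConv (C →ₗ[k] k)) a ∈ distLE k C 0 := by
  intro c hc
  rw [zero_add, pow_one] at hc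
  rw [LinearMap.convAlgebraMap_apply, show Coalgebra.counit (R := k) c = 0 from hc, map_zero,
    smul_zero]

variable (k C) in
/-- The algebra of distributions, with the convolution product. -/
def Dist : Subalgebra k (WithConv (C →ₗ[k] k)) where
  carrier := {μ | ∃ n, μ ∈ distLE k C n}
  mul_mem' := fun ⟨_, hμ⟩ ⟨_, hν⟩ => ⟨_, convMul_mem hμ hν⟩
  add_mem' := fun ⟨n, hμ⟩ ⟨m, hν⟩ => ⟨max n m, add_mem (distLE_mono (le_max_left n m) hμ)
    (distLE_mono (le_max_right n m) hν)⟩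
  algebraMap_mem' a := ⟨0, algebraMap_mem_distLE a⟩

instance : Ring (Dist k C) := Subalgebra.toRing _

instance : Algebra k (Dist k C) := Subalgebra.algebra _

variable (k C) in
/-- The filtration of the algebra of distributions by the order. -/
def distFil (n : ℕ) : Submodule k (Dist k C) := (distLE k C n).comap (Dist k C).val.toLinearMap

end Dist

/-! ### The group `SL₂` -/

section SL2

variable (k : Type) [CommRing k]

/-- The ideal of `SL₂` in the coordinate ring of the `2 × 2` matrices, generated by `det - 1`. -/
def SL2Ideal : Ideal (MvPolynomial (Fin 2 × Fin 2) k) :=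
  Ideal.span {(Matrix.of fun i j : Fin 2 => (MvPolynomial.X (i, j) :
    MvPolynomial (Fin 2 × Fin 2) k)).det - 1}

/-- The coordinate ring of `SL₂`. -/
def SL2Ring : Type := MvPolynomial (Fin 2 × Fin 2) k ⧸ SL2Ideal k

instance : CommRing (SL2Ring k) :=
  inferInstanceAs (CommRing (MvPolynomial (Fin 2 × Fin 2) k ⧸ SL2Ideal k))

namespace SL2Ring

/-- The algebra structure of the coordinate ring. -/
instance algebra : Algebra k (SL2Ring k) :=
  inferInstanceAs (Algebra k (MvPolynomial (Fin 2 × Fin 2) k ⧸ SL2Ideal k))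

/-- The quotient map. -/
def mk : MvPolynomial (Fin 2 × Fin 2) k →ₐ[k] SL2Ring k :=
  Ideal.Quotient.mkₐ k (SL2Ideal k)

/-- The universal matrix of determinant one. -/
def gen : Matrix (Fin 2) (Fin 2) (SL2Ring k) := Matrix.of fun i j => mk k (MvPolynomial.X (i, j))

theorem det_gen : (gen k).det = 1 := by
  have h : gen k = (mk k).mapMatrix (Matrix.of fun i j : Fin 2 => (MvPolynomial.X (i, j) :
    MvPolynomial (Fin 2 × Fin 2) k)) := rfl
  rw [h, ← AlgHom.map_det, ← map_one (mk k)]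
  exact Ideal.Quotient.eq.mpr (Ideal.subset_span rfl)

variable {k} {A : Type} [CommRing A] [Algebra k A]

theorem aeval_eq_zero (M : Matrix (Fin 2) (Fin 2) A) (hM : M.det = 1)
    (x : MvPolynomial (Fin 2 × Fin 2) k) (hx : x ∈ SL2Ideal k) :
    MvPolynomial.aeval (fun ij : Fin 2 × Fin 2 => M ij.1 ij.2) x = 0 := by
  have h : SL2Ideal k ≤ RingHom.ker (MvPolynomial.aeval (R := k)
      (fun ij : Fin 2 × Fin 2 => M ij.1 ij.2)) := by
    rw [SL2Ideal, Ideal.span_le, Set.singleton_subset_iff, SetLike.mem_coe, RingHom.mem_ker]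
    rw [Matrix.det_fin_two] at hM ⊢
    simp [hM]
  exact h hx

/-- The universal property of the coordinate ring of `SL₂`: a point of `SL₂` with values in `A`
is a matrix of determinant one. -/
def lift (M : Matrix (Fin 2) (Fin 2) A) (hM : M.det = 1) : SL2Ring k →ₐ[k] A :=
  Ideal.Quotient.liftₐ (SL2Ideal k) (MvPolynomial.aeval fun ij : Fin 2 × Fin 2 => M ij.1 ij.2)
    (aeval_eq_zero M hM)

theorem lift_gen (M : Matrix (Fin 2) (Fin 2) A) (hM : M.det = 1) (i j : Fin 2) :
    lift (k := k) M hM (gen k i j) = M i j := by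
  change MvPolynomial.aeval (fun ij : Fin 2 × Fin 2 => M ij.1 ij.2) (MvPolynomial.X (i, j)) = _
  simp

theorem hom_ext {f g : SL2Ring k →ₐ[k] A} (h : ∀ i j, f (gen k i j) = g (gen k i j)) : f = g := by
  apply Ideal.Quotient.algHom_ext
  apply MvPolynomial.algHom_ext
  intro ij
  exact h ij.1 ij.2

variable (k)

/-- The comultiplication: the matrix of coordinates is multiplicative. -/
def comul : SL2Ring k →ₐ[k] SL2Ring k ⊗[k] SL2Ring k :=
  lift ((Algebra.TensorProduct.includeLeft : SL2Ring k →ₐ[k] _).mapMatrix (gen k) *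
    (Algebra.TensorProduct.includeRight : SL2Ring k →ₐ[k] _).mapMatrix (gen k)) (by
      rw [Matrix.det_mul, ← AlgHom.map_det, ← AlgHom.map_det, det_gen, map_one, map_one, one_mul])

/-- The counit: evaluation at the identity matrix. -/
def counit : SL2Ring k →ₐ[k] k := lift 1 Matrix.det_one

theorem comul_gen (i j : Fin 2) :
    comul k (gen k i j) = ∑ l, gen k i l ⊗ₜ[k] gen k l j := by
  rw [comul, lift_gen, Matrix.mul_apply]
  simp

theorem counit_gen (i j : Fin 2) : counit k (gen k i j) = (1 : Matrix (Fin 2) (Fin 2) k) i j :=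
  lift_gen ..

/-- The bialgebra structure on the coordinate ring of `SL₂`. -/
instance bialgebra : Bialgebra k (SL2Ring k) :=
  Bialgebra.ofAlgHom (comul k) (counit k)
    (by
      apply hom_ext
      intro i j
      simp [comul_gen, TensorProduct.add_tmul, TensorProduct.tmul_add]
      abel)
    (by
      apply hom_ext
      intro i j
      fin_cases i <;> fin_cases j <;> simp [comul_gen, counit_gen])
    (by
      apply hom_ext
      intro i j
      fin_cases i <;> fin_cases j <;> simp [comul_gen, counit_gen])

/-- The point `1 + ε H` of `SL₂` with values in the dual numbers, where `H = diag(1, -1)`. -/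
def pointH : SL2Ring k →ₐ[k] DualNumber k :=
  lift !![1 + DualNumber.eps, 0; 0, 1 - DualNumber.eps] (by
    rw [Matrix.det_fin_two_of]
    ring_nf
    rw [pow_two, DualNumber.eps_mul_eps, sub_zero])

/-- The element `H = diag(1, -1)` of the Lie algebra of `SL₂`, as a distribution of order `≤ 1`:
the coefficient of `ε` in the value at the point `1 + ε H`. -/
def distH : WithConv (SL2Ring k →ₗ[k] k) :=
  WithConv.toConv ((TrivSqZeroExt.sndHom k k) ∘ₗ (pointH k).toLinearMap)

theorem fst_pointH (c : SL2Ring k) (hc : c ∈ augIdeal k (SL2Ring k)) :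
    TrivSqZeroExt.fst (pointH k c) = 0 := by
  have h : (TrivSqZeroExt.fstHom k k k).comp (pointH k) = counit k := by
    apply hom_ext
    intro i j
    rw [counit_gen, AlgHom.comp_apply, pointH, lift_gen]
    fin_cases i <;> fin_cases j <;> simp
  exact (DFunLike.congr_fun h c).trans hc

theorem distH_mem : distH k ∈ distLE k (SL2Ring k) 1 := by
  intro c hc
  rw [one_add_one_eq_two, pow_two] at hc
  refine Submodule.mul_induction_on hc (fun a ha b hb => ?_) (fun a b ha hb => ?_)
  · change TrivSqZeroExt.snd (pointH k (a * b)) = 0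
    rw [map_mul, TrivSqZeroExt.snd_mul, fst_pointH k a ha, fst_pointH k b hb]
    simp
  · change (distH k).ofConv (a + b) = 0
    rw [map_add]
    exact (congrArg₂ (· + ·) ha hb).trans (add_zero 0)

end SL2Ring

open SL2Ring

/-- The element `H` of the algebra of distributions of `SL₂`. -/
def elemH : Dist k (SL2Ring k) := ⟨distH k, 1, distH_mem k⟩

variable (p : ℕ) [Fact p.Prime]

/-- The divided binomial `H (H - 1) ⋯ (H - i + 1) / i!`, for `i < p`. -/
def binomH (i : ℕ) : Dist (ZMod p) (SL2Ring (ZMod p)) :=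
  ((i.factorial : ZMod p)⁻¹) • Polynomial.aeval (elemH (ZMod p)) (descPochhammer (ZMod p) i)

/-- The norm element `Δ_T = ∑_{i < p} (-1)^i binom(H, i)`. -/
def deltaT : Dist (ZMod p) (SL2Ring (ZMod p)) :=
  ∑ i ∈ Finset.range p, (-1 : ZMod p) ^ i • binomH p i

theorem elemH_pow_mem (j : ℕ) : elemH k ^ j ∈ distFil k (SL2Ring k) (2 * j) := by
  induction j with
  | zero =>
    rw [pow_zero]
    have := algebraMap_mem_distLE (k := k) (C := SL2Ring k) 1
    rw [map_one] at this
    exact this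
  | succ j ih =>
    rw [pow_succ]
    exact convMul_mem (n := 2 * j) (m := 1) ih (distH_mem k)

theorem distFil_mono {C : Type} [CommRing C] [Bialgebra k C] : Monotone (distFil k C) :=
  fun _ _ h => Submodule.comap_mono (distLE_mono h)

theorem deltaT_mem {n : ℕ} (hn : 2 * p ≤ n + 2) :
    deltaT p ∈ distFil (ZMod p) (SL2Ring (ZMod p)) n := by
  refine Submodule.sum_mem _ fun i hi => Submodule.smul_mem _ _ (Submodule.smul_mem _ _ ?_)
  rw [Polynomial.aeval_eq_sum_range]
  refine Submodule.sum_mem _ fun j hj => Submodule.smul_mem _ _ ?_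
  rw [descPochhammer_natDegree, Finset.mem_range] at hj
  rw [Finset.mem_range] at hi
  exact distFil_mono (ZMod p) (by omega) (elemH_pow_mem (ZMod p) j)

theorem deltaT_mem_level {m : ℕ} (hm : 0 < m) :
    deltaT p ∈ distFil (ZMod p) (SL2Ring (ZMod p)) (2 * p ^ m - 1) := by
  apply deltaT_mem
  have := Nat.le_self_pow hm.ne' p
  omega

end SL2

/-! ### Extension of differential operators to the field of fractions -/

section Extension

variable {k S L : Type} [CommRing k] [CommRing S] [IsDomain S] [Algebra k S] [Field L]
  [Algebra k L] [Algebra S L] [IsFractionRing S L] [IsScalarTower k S L]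

theorem diffOpLT_ext_zero (n : ℕ) : ∀ Q : Module.End k L, Q ∈ diffOpLT k L n →
    (∀ s : S, Q (algebraMap S L s) = 0) → Q = 0 := by
  induction n with
  | zero => exact fun Q hQ _ => hQ
  | succ n ih =>
    intro Q hQ h
    have h1 : ∀ b : S, Q * LinearMap.mulLeft k (algebraMap S L b) =
        LinearMap.mulLeft k (algebraMap S L b) * Q := fun b => by
      refine sub_eq_zero.mp (ih _ (hQ _) fun s => ?_)
      simp [← map_mul, h]
    ext x
    obtain ⟨a, b, hb, rfl⟩ := IsFractionRing.div_surjective (A := S) x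
    have hb' : algebraMap S L b ≠ 0 := by
      simpa using nonZeroDivisors.ne_zero hb
    have h2 := congrArg (fun f => f (algebraMap S L a / algebraMap S L b)) (h1 b)
    simp only [Module.End.mul_apply, LinearMap.mulLeft_apply, mul_div_cancel₀ _ hb', h] at h2
    have h3 := h2.symm
    simp only [mul_eq_zero, hb', false_or] at h3
    simpa using h3

variable (L) in
/-- The functional `l ⊗ s ↦ l P(s)` on `L ⊗ S` attached to an endomorphism `P` of `S`. -/
def diagFun (P : Module.End k S) : L ⊗[k] S →ₗ[L] L :=
  LinearMap.liftBaseChange L ((IsScalarTower.toAlgHom k S L).toLinearMap ∘ₗ P)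

theorem diagFun_tmul (P : Module.End k S) (l : L) (s : S) :
    diagFun L P (l ⊗ₜ s) = l * algebraMap S L (P s) := by
  simp [diagFun]

variable (k S L) in
/-- The ideal of the diagonal in `L ⊗ S`. -/
def diagIdeal : Ideal (L ⊗[k] S) :=
  Ideal.span (Set.range fun s : S => (1 : L) ⊗ₜ[k] s - algebraMap S L s ⊗ₜ[k] (1 : S))

theorem diagFun_eq_zero (n : ℕ) : ∀ P : Module.End k S, P ∈ diffOpLT k S n →
    ∀ r ∈ diagIdeal k S L ^ n, diagFun L P r = 0 := by
  induction n with
  | zero =>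
    intro P hP r _
    rw [show P = 0 from hP]
    simp [diagFun]
  | succ n ih =>
    intro P hP r hr
    rw [pow_succ] at hr
    refine Submodule.mul_induction_on hr (fun a ha b hb => ?_) (fun a b ha hb => by
      rw [map_add, ha, hb, add_zero])
    revert a
    refine Submodule.span_induction (p := fun b _ => ∀ a ∈ diagIdeal k S L ^ n,
      diagFun L P (a * b) = 0) ?_ (by simp) ?_ ?_ hb
    · rintro _ ⟨s, rfl⟩ a ha
      rw [← ih _ (hP s) a ha]
      clear ha
      induction a with
      | zero => simp
      | add x y hx hy => rw [add_mul, map_add, map_add, hx, hy]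
      | tmul l t =>
        simp [mul_sub, Algebra.TensorProduct.tmul_mul_tmul, mul_comm t s, mul_assoc, diagFun_tmul]
    · intro x y _ _ hx hy a ha
      rw [mul_add, map_add, hx a ha, hy a ha, add_zero]
    · intro c x _ hx a ha
      rw [smul_eq_mul, ← mul_assoc]
      exact hx _ (Ideal.mul_mem_right _ _ ha)

theorem exists_extension (n : ℕ) (P : Module.End k S) (hP : P ∈ diffOpLT k S n) :
    ∃ Q ∈ diffOpLT k L n, ∀ s : S, Q (algebraMap S L s) = algebraMap S L (P s) := by
  let J : Ideal (L ⊗[k] S) := diagIdeal k S L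
  let R := (L ⊗[k] S) ⧸ J ^ n
  let J' : Ideal R := J.map (Ideal.Quotient.mk (J ^ n))
  have hJ' : J' ^ n = ⊥ := by
    rw [← Ideal.map_pow, Ideal.map_quotient_self]
  let β₀ : S →ₐ[k] R := (Ideal.Quotient.mkₐ k (J ^ n)).comp Algebra.TensorProduct.includeRight
  have hβ₀ : ∀ s, β₀ s - algebraMap L R (algebraMap S L s) ∈ J' := fun s =>
    Ideal.mem_map_of_mem (Ideal.Quotient.mk (J ^ n)) (Ideal.subset_span ⟨s, rfl⟩)
  have hu : ∀ y : nonZeroDivisors S, IsUnit (β₀ y) := by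
    intro y
    have h1 : IsUnit (algebraMap L R (algebraMap S L y)) :=
      (IsUnit.mk0 _ (by simp)).map _
    have h2 : IsNilpotent (β₀ y - algebraMap L R (algebraMap S L y)) :=
      ⟨n, by
        have := Ideal.pow_mem_pow (hβ₀ y) n
        rwa [hJ'] at this⟩
    have := h2.isUnit_add_left_of_commute h1 (Commute.all _ _)
    rwa [add_sub_cancel] at this
  let β : L →ₐ[k] R := IsLocalization.liftAlgHom (M := nonZeroDivisors S) (f := β₀) hu
  have hβs : ∀ s, β (algebraMap S L s) = β₀ s := fun s => by
    simp [β]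
  have hβ : ∀ l, β l - algebraMap L R l ∈ J' := by
    have : (Ideal.Quotient.mk J').comp (β : L →+* R) =
        (Ideal.Quotient.mk J').comp (algebraMap L R) := by
      apply IsLocalization.ringHom_ext (nonZeroDivisors S)
      ext s
      simp only [RingHom.comp_apply]
      rw [Ideal.Quotient.eq]
      have := hβ₀ s
      rw [← hβs s] at this
      exact this
    intro l
    rw [← Ideal.Quotient.eq]
    exact DFunLike.congr_fun this l
  let Φ : R →ₗ[L] L := ((J ^ n).restrictScalars L).liftQ (diagFun L P) (diagFun_eq_zero n P hP)
  have hΦ : ∀ x, Φ (Ideal.Quotient.mk (J ^ n) x) = diagFun L P x := fun x => rfl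
  refine ⟨Φ.restrictScalars k ∘ₗ β.toLinearMap, comp_mem_diffOpLT J' β hβ n Φ ?_, fun s => ?_⟩
  · intro r hr
    rw [hJ'] at hr
    rw [show r = 0 from hr, map_zero]
  · change Φ (β (algebraMap S L s)) = _
    rw [hβs]
    change Φ (Ideal.Quotient.mk (J ^ n) ((1 : L) ⊗ₜ[k] s)) = _
    rw [hΦ, diagFun_tmul, one_mul]

theorem eq_of_agree {n m : ℕ} {Q Q' : Module.End k L} (hQ : Q ∈ diffOpLT k L n)
    (hQ' : Q' ∈ diffOpLT k L m)
    (h : ∀ s : S, Q (algebraMap S L s) = Q' (algebraMap S L s)) : Q = Q' := by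
  refine sub_eq_zero.mp (diffOpLT_ext_zero (S := S) (max n m) _ (sub_mem
    (diffOpLT_mono (le_max_left n m) hQ) (diffOpLT_mono (le_max_right n m) hQ')) fun s => ?_)
  rw [LinearMap.sub_apply, h, sub_self]

open Classical in
variable (L) in
/-- The unique extension to the field of fractions of a differential operator. -/
def extOp (P : Module.End k S) : Module.End k L :=
  if h : ∃ n, P ∈ diffOpLT k S n then (exists_extension (L := L) h.choose P h.choose_spec).choose
  else 0

theorem extOp_spec {n : ℕ} {P : Module.End k S} (hP : P ∈ diffOpLT k S n) :
    extOp L P ∈ diffOpLT k L n ∧ ∀ s : S, extOp L P (algebraMap S L s) = algebraMap S L (P s) := by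
  have h : ∃ n, P ∈ diffOpLT k S n := ⟨n, hP⟩
  have h1 := (exists_extension (L := L) h.choose P h.choose_spec).choose_spec
  obtain ⟨Q, hQ, hQs⟩ := exists_extension (L := L) n P hP
  have h2 : extOp L P = Q := by
    rw [extOp, dif_pos h]
    exact eq_of_agree (S := S) h1.1 hQ fun s => by rw [h1.2, hQs]
  rw [h2]
  exact ⟨hQ, hQs⟩

/-- A homogeneous differential operator maps homogeneous fractions to homogeneous fractions. -/
theorem homogeneous_fraction (G : ℕ → Submodule k S) [GradedAlgebra G] (n : ℕ) :
    ∀ Q : Module.End k L, Q ∈ diffOpLT k L n → ∀ e : ℕ,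
    (∀ j, ∀ s ∈ G j, ∃ s' ∈ G (j + e), Q (algebraMap S L s) = algebraMap S L s') →
    ∀ i d, ∀ a ∈ G i, ∀ b ∈ G d, b ≠ 0 → ∃ c ∈ G (i + e + n * d),
      Q (algebraMap S L a / algebraMap S L b) = algebraMap S L c / algebraMap S L b ^ (n + 1) := by
  induction n with
  | zero =>
    intro Q hQ e _ i d a _ b _ _
    refine ⟨0, zero_mem _, ?_⟩
    rw [show Q = 0 from hQ]
    simp
  | succ n ih =>
    intro Q hQ e hG i d a ha b hb hb0
    have hb' : algebraMap S L b ≠ 0 := by simpa using hb0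
    obtain ⟨c', hc', h1⟩ := ih _ (hQ (algebraMap S L b)) (e + d) (fun j s hs => by
      obtain ⟨s', hs', h⟩ := hG j s hs
      obtain ⟨s'', hs'', h'⟩ := hG (d + j) (b * s) (SetLike.mul_mem_graded hb hs)
      refine ⟨s'' - b * s', sub_mem ?_ ?_, ?_⟩
      · rwa [show j + (e + d) = d + j + e by ring]
      · rw [show j + (e + d) = d + (j + e) by ring]
        exact SetLike.mul_mem_graded hb hs'
      · simp [h, ← h']) i d a ha b hb hb0
    obtain ⟨a', ha', h2⟩ := hG i a ha
    refine ⟨a' * b ^ (n + 1) - c', sub_mem ?_ ?_, ?_⟩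
    · have := SetLike.mul_mem_graded ha' (SetLike.pow_mem_graded (n + 1) hb)
      rwa [smul_eq_mul] at this
    · rwa [show i + e + (n + 1) * d = i + (e + d) + n * d by ring]
    · simp only [LinearMap.sub_apply, Module.End.mul_apply, LinearMap.mulLeft_apply,
        mul_div_cancel₀ _ hb', h2] at h1
      have h3 : Q (algebraMap S L a / algebraMap S L b) =
          (algebraMap S L a' - algebraMap S L c' / algebraMap S L b ^ (n + 1)) /
            algebraMap S L b := by
        rw [← h1]
        field_simp
        ring
      rw [h3, map_sub, map_mul, map_pow]
      field_simp
      ring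

end Extension

section Functional

variable {k S C : Type} [CommRing k] [CommRing S] [Algebra k S] [CommRing C] [Bialgebra k C]

variable (S) in
/-- The functional `s ⊗ c ↦ μ(c) s`. -/
def actFun (μ : WithConv (C →ₗ[k] k)) : S ⊗[k] C →ₗ[S] S :=
  LinearMap.liftBaseChange S (Algebra.linearMap k S ∘ₗ μ.ofConv)

theorem actFun_tmul (μ : WithConv (C →ₗ[k] k)) (s : S) (c : C) :
    actFun S μ (s ⊗ₜ c) = μ.ofConv c • s := by
  simp [actFun, Algebra.smul_def, mul_comm]

theorem actFun_add (μ ν : WithConv (C →ₗ[k] k)) : actFun S (μ + ν) = actFun S μ + actFun S ν := by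
  ext c
  simp [actFun]

theorem actFun_eq_zero {n : ℕ} {μ : WithConv (C →ₗ[k] k)} (hμ : μ ∈ distLE k C n)
    (r : S ⊗[k] C) (hr : r ∈ ((augIdeal k C).map
      (Algebra.TensorProduct.includeRight : C →ₐ[k] S ⊗[k] C)) ^ (n + 1)) : actFun S μ r = 0 := by
  rw [← Ideal.map_pow] at hr
  have h : ∀ (s : S ⊗[k] C), ∀ i ∈ augIdeal k C ^ (n + 1), actFun S μ (s * (1 ⊗ₜ i)) = 0 := by
    intro s i hi
    induction s with
    | zero => simp
    | add s t hs ht => rw [add_mul, map_add, hs, ht, add_zero]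
    | tmul a b =>
      have : μ.ofConv (b * i) = 0 := hμ _ (Ideal.mul_mem_left _ _ hi)
      rw [Algebra.TensorProduct.tmul_mul_tmul, actFun_tmul, this, zero_smul]
  exact map_ideal_eq_zero
    ((Algebra.TensorProduct.includeRight : C →ₐ[k] S ⊗[k] C) : C →+* S ⊗[k] C) _
    (actFun S μ).toAddMonoidHom h r hr

theorem actFun_mul (δ : S →ₐ[k] S ⊗[k] C)
    (hδ : ∀ s, Algebra.TensorProduct.map δ (AlgHom.id k C) (δ s) =
      (Algebra.TensorProduct.assoc k k k _ _ _).symm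
        (Algebra.TensorProduct.map (AlgHom.id k _) (Bialgebra.comulAlgHom k C) (δ s)))
    (μ ν : WithConv (C →ₗ[k] k)) (s : S) :
    actFun S (μ * ν) (δ s) = actFun S μ (δ (actFun S ν (δ s))) := by
  have h1 : ∀ x : S ⊗[k] C, actFun S μ (δ (actFun S ν x)) =
      actFun S μ (actFun (S ⊗[k] C) ν (Algebra.TensorProduct.map δ (AlgHom.id k C) x)) := by
    intro x
    induction x with
    | zero => simp
    | add x y hx hy => simp only [map_add, hx, hy]
    | tmul a c => simp [actFun_tmul]
  have h2 : ∀ x : S ⊗[k] C, actFun S (μ * ν) x = actFun S μ (actFun (S ⊗[k] C) ν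
      ((Algebra.TensorProduct.assoc k k k _ _ _).symm
        (Algebra.TensorProduct.map (AlgHom.id k _) (Bialgebra.comulAlgHom k C) x))) := by
    intro x
    induction x with
    | zero => simp
    | add x y hx hy => simp only [map_add, hx, hy]
    | tmul a c =>
      rw [actFun_tmul]
      change (μ * ν) c • a = _
      rw [LinearMap.convMul_apply, Algebra.TensorProduct.map_tmul, Bialgebra.comulAlgHom_apply]
      generalize (Coalgebra.comul c : C ⊗[k] C) = y
      induction y with
      | zero => simp
      | add x y hx hy =>
        simp only [map_add, TensorProduct.tmul_add, add_smul, hx, hy]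
      | tmul b c =>
        rw [TensorProduct.map_tmul, LinearMap.mul'_apply]
        change _ = actFun S μ (actFun (S ⊗[k] C) ν ((a ⊗ₜ b) ⊗ₜ c))
        rw [actFun_tmul, LinearMap.map_smul_of_tower, actFun_tmul, smul_smul, mul_comm]
  rw [h1, h2, hδ]

end Functional

/-! ### The action of the distributions of `SL₂` on homogeneous coordinates -/

section Action

variable (k : Type) [Field k]

/-- The coaction on `k[x₀, x₁] = Sym V`, for the standard representation `V` of `SL₂`, with basis
`x₀, x₁`: `x_j ↦ ∑ i, x_i ⊗ g_{ij}`. -/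
def coaction : MvPolynomial (Fin 2) k →ₐ[k] MvPolynomial (Fin 2) k ⊗[k] SL2Ring k :=
  MvPolynomial.aeval fun j => ∑ i, MvPolynomial.X i ⊗ₜ[k] SL2Ring.gen k i j

variable {k}

/-- The action of distributions on `k[x₀, x₁]`: `μ` acts by `(id ⊗ μ) ∘ coaction`. -/
def act (μ : WithConv (SL2Ring k →ₗ[k] k)) : Module.End k (MvPolynomial (Fin 2) k) :=
  (actFun _ μ).restrictScalars k ∘ₗ (coaction k).toLinearMap

theorem act_mem {n : ℕ} {μ : WithConv (SL2Ring k →ₗ[k] k)} (hμ : μ ∈ distLE k (SL2Ring k) n) :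
    act μ ∈ diffOpLT k (MvPolynomial (Fin 2) k) (n + 1) := by
  let incl : SL2Ring k →ₐ[k] MvPolynomial (Fin 2) k ⊗[k] SL2Ring k :=
    Algebra.TensorProduct.includeRight
  refine comp_mem_diffOpLT ((augIdeal k (SL2Ring k)).map incl) (coaction k) ?_ (n + 1)
    (actFun _ μ) (actFun_eq_zero hμ)
  · have : (Ideal.Quotient.mkₐ k ((augIdeal k (SL2Ring k)).map incl)).comp (coaction k) =
        (Ideal.Quotient.mkₐ k ((augIdeal k (SL2Ring k)).map incl)).comp
          Algebra.TensorProduct.includeLeft := by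
      apply MvPolynomial.algHom_ext
      intro j
      refine Ideal.Quotient.eq.mpr ?_
      have h : ∀ i, SL2Ring.gen k i j - algebraMap k _ ((1 : Matrix (Fin 2) (Fin 2) k) i j) ∈
          augIdeal k (SL2Ring k) := fun i => by
        change SL2Ring.counit k _ = 0
        rw [map_sub, SL2Ring.counit_gen, AlgHom.commutes]
        simp
      have h' : ∀ i, (MvPolynomial.X i : MvPolynomial (Fin 2) k) ⊗ₜ[k] (SL2Ring.gen k i j -
          algebraMap k _ ((1 : Matrix (Fin 2) (Fin 2) k) i j)) ∈
            (augIdeal k (SL2Ring k)).map incl := fun i => by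
        have := Ideal.mul_mem_left _ ((MvPolynomial.X i : MvPolynomial (Fin 2) k) ⊗ₜ[k]
          (1 : SL2Ring k)) (Ideal.mem_map_of_mem incl (h i))
        simpa [incl] using this
      convert! add_mem (h' 0) (h' 1) using 1
      rcases (show j = 0 ∨ j = 1 by omega) with rfl | rfl <;>
        simp [coaction, TensorProduct.tmul_sub] <;> ring
    intro a
    exact Ideal.Quotient.eq.mp (DFunLike.congr_fun this a)

theorem coaction_coassoc (s : MvPolynomial (Fin 2) k) :
    Algebra.TensorProduct.map (coaction k) (AlgHom.id k (SL2Ring k)) (coaction k s) =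
      (Algebra.TensorProduct.assoc k k k _ _ _).symm
        (Algebra.TensorProduct.map (AlgHom.id k _) (SL2Ring.comul k) (coaction k s)) := by
  have : (Algebra.TensorProduct.map (coaction k) (AlgHom.id k (SL2Ring k))).comp (coaction k) =
      ((Algebra.TensorProduct.assoc k k k _ _ _).symm.toAlgHom.comp
        (Algebra.TensorProduct.map (AlgHom.id k _) (SL2Ring.comul k))).comp (coaction k) := by
    apply MvPolynomial.algHom_ext
    intro j
    simp [coaction, SL2Ring.comul_gen, TensorProduct.add_tmul, TensorProduct.tmul_add]
    abel
  exact DFunLike.congr_fun this s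

theorem act_mul (μ ν : WithConv (SL2Ring k →ₗ[k] k)) : act (μ * ν) = act μ * act ν := by
  refine LinearMap.ext fun s => ?_
  exact actFun_mul (coaction k) coaction_coassoc μ ν s

theorem act_one : act (1 : WithConv (SL2Ring k →ₗ[k] k)) = 1 := by
  have h : ∀ s : MvPolynomial (Fin 2) k, Algebra.TensorProduct.rid k k _
      (Algebra.TensorProduct.map (AlgHom.id k _) (SL2Ring.counit k) (coaction k s)) = s := by
    have : ((Algebra.TensorProduct.rid k k (MvPolynomial (Fin 2) k)).toAlgHom.comp
        (Algebra.TensorProduct.map (AlgHom.id k _) (SL2Ring.counit k))).comp (coaction k) =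
          AlgHom.id k _ := by
      apply MvPolynomial.algHom_ext
      intro j
      rcases (show j = 0 ∨ j = 1 by omega) with rfl | rfl <;>
        simp [coaction, SL2Ring.counit_gen]
    exact fun s => DFunLike.congr_fun this s
  have h' : ∀ x : MvPolynomial (Fin 2) k ⊗[k] SL2Ring k, actFun _ 1 x =
      Algebra.TensorProduct.rid k k _
      (Algebra.TensorProduct.map (AlgHom.id k _) (SL2Ring.counit k) x) := by
    intro x
    induction x with
    | zero => simp
    | add x y hx hy => simp only [map_add, hx, hy]
    | tmul a c =>
      rw [actFun_tmul]
      simp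
      rfl
  refine LinearMap.ext fun s => ?_
  exact (h' _).trans (h s)

theorem act_add (μ ν : WithConv (SL2Ring k →ₗ[k] k)) : act (μ + ν) = act μ + act ν := by
  refine LinearMap.ext fun s => ?_
  change actFun _ (μ + ν) (coaction k s) = _
  rw [actFun_add]
  rfl

variable (k) in
/-- The elements of degree `d` of `k[x₀, x₁] ⊗ k[SL₂]`. -/
def degTensor (d : ℕ) : Submodule k (MvPolynomial (Fin 2) k ⊗[k] SL2Ring k) :=
  Submodule.span k {x | ∃ a ∈ MvPolynomial.homogeneousSubmodule (Fin 2) k d,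
    ∃ c : SL2Ring k, a ⊗ₜ[k] c = x}

theorem degTensor_mul {d e : ℕ} {x y : MvPolynomial (Fin 2) k ⊗[k] SL2Ring k}
    (hx : x ∈ degTensor k d) (hy : y ∈ degTensor k e) : x * y ∈ degTensor k (d + e) := by
  have : degTensor k d * degTensor k e ≤ degTensor k (d + e) := by
    rw [degTensor, degTensor, Submodule.span_mul_span, Submodule.span_le]
    rintro _ ⟨_, ⟨a, ha, c, rfl⟩, _, ⟨a', ha', c', rfl⟩, rfl⟩
    exact Submodule.subset_span ⟨a * a', SetLike.mul_mem_graded ha ha', c * c',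
      (Algebra.TensorProduct.tmul_mul_tmul ..).symm⟩
  exact this (Submodule.mul_mem_mul hx hy)

theorem degTensor_pow {d : ℕ} {x : MvPolynomial (Fin 2) k ⊗[k] SL2Ring k}
    (hx : x ∈ degTensor k d) (n : ℕ) : x ^ n ∈ degTensor k (n * d) := by
  induction n with
  | zero =>
    rw [pow_zero, zero_mul]
    exact Submodule.subset_span ⟨1, SetLike.one_mem_graded _, 1, rfl⟩
  | succ n ih =>
    rw [pow_succ, add_mul, one_mul]
    exact degTensor_mul ih hx

theorem coaction_mem (d : ℕ) (s : MvPolynomial (Fin 2) k)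
    (hs : s ∈ MvPolynomial.homogeneousSubmodule (Fin 2) k d) : coaction k s ∈ degTensor k d := by
  have hX : ∀ j, coaction k (MvPolynomial.X j) ∈ degTensor k 1 := fun j => by
    rw [coaction, MvPolynomial.aeval_X]
    exact Submodule.sum_mem _ fun i _ => Submodule.subset_span
      ⟨MvPolynomial.X i, MvPolynomial.isHomogeneous_X _ _, _, rfl⟩
  rw [← MvPolynomial.support_sum_monomial_coeff s, map_sum]
  refine Submodule.sum_mem _ fun v hv => ?_
  have hv' : v 0 + v 1 = d := by
    have := hs (MvPolynomial.mem_support_iff.mp hv)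
    simpa [Finsupp.weight_apply, Finsupp.sum_fintype] using this
  have h : MvPolynomial.monomial v (MvPolynomial.coeff v s) = MvPolynomial.coeff v s •
      ((MvPolynomial.X 0 : MvPolynomial (Fin 2) k) ^ v 0 * MvPolynomial.X 1 ^ v 1) := by
    rw [MvPolynomial.monomial_eq, Finsupp.prod_fintype _ _ (by simp), Fin.prod_univ_two,
      MvPolynomial.smul_eq_C_mul]
  rw [h, map_smul, map_mul, map_pow, map_pow]
  refine Submodule.smul_mem _ _ ?_
  have := degTensor_mul (degTensor_pow (hX 0) (v 0)) (degTensor_pow (hX 1) (v 1))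
  rwa [mul_one, mul_one, hv'] at this

theorem act_homogeneous (μ : WithConv (SL2Ring k →ₗ[k] k)) (d : ℕ) (s : MvPolynomial (Fin 2) k)
    (hs : s ∈ MvPolynomial.homogeneousSubmodule (Fin 2) k d) :
    act μ s ∈ MvPolynomial.homogeneousSubmodule (Fin 2) k d := by
  have h := coaction_mem d s hs
  change actFun _ μ (coaction k s) ∈ _
  refine Submodule.span_induction (p := fun x _ => actFun _ μ x ∈
    MvPolynomial.homogeneousSubmodule (Fin 2) k d) ?_ ?_ ?_ ?_ h
  · rintro _ ⟨a, ha, c, rfl⟩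
    rw [actFun_tmul]
    exact Submodule.smul_mem _ _ ha
  · rw [map_zero]
    exact zero_mem _
  · intro x y _ _ hx hy
    rw [map_add]
    exact add_mem hx hy
  · intro c x _ hx
    rw [LinearMap.map_smul_of_tower]
    exact Submodule.smul_mem _ _ hx

end Action

/-! ### The projective line -/

section P1

variable (k : Type) [Field k]

/-- The grading of `k[x₀, x₁]`. -/
abbrev gr : ℕ → Submodule k (MvPolynomial (Fin 2) k) := MvPolynomial.homogeneousSubmodule (Fin 2) k

instance : GradedAlgebra (gr k) := MvPolynomial.gradedAlgebra

/-- The projective line `Proj k[x₀, x₁]`. -/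
abbrev P1 : Scheme.{0} := Proj (gr k)

/-- The structure morphism of the projective line. -/
def P1.toSpec : P1 k ⟶ Spec (.of k) :=
  Proj.toSpecZero (gr k) ≫ Spec.map (CommRingCat.ofHom (algebraMap k (gr k 0)))

/-- The local ring of the projective line at the point `x`. -/
abbrev P1.At (x : ProjectiveSpectrum (gr k)) : Type :=
  HomogeneousLocalization.AtPrime (gr k) x.asHomogeneousIdeal.toIdeal

/-- The field of fractions of `k[x₀, x₁]`. -/
abbrev P1.Frac : Type := FractionRing (MvPolynomial (Fin 2) k)

variable {k}

theorem P1.primeCompl_isUnit (x : ProjectiveSpectrum (gr k))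
    (b : x.asHomogeneousIdeal.toIdeal.primeCompl) :
    IsUnit (algebraMap (MvPolynomial (Fin 2) k) (P1.Frac k) b) := by
  have : (b : MvPolynomial (Fin 2) k) ≠ 0 := fun h => b.2 (h ▸ zero_mem _)
  exact IsUnit.mk0 _ (by simpa using this)

/-- The embedding of the local rings in the field of fractions of `k[x₀, x₁]`. -/
def P1.toFrac (x : ProjectiveSpectrum (gr k)) : P1.At k x →+* P1.Frac k :=
  (IsLocalization.lift (M := x.asHomogeneousIdeal.toIdeal.primeCompl)
    (S := Localization.AtPrime x.asHomogeneousIdeal.toIdeal)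
    (P1.primeCompl_isUnit x)).comp (algebraMap (P1.At k x)
      (Localization.AtPrime x.asHomogeneousIdeal.toIdeal))

theorem P1.toFrac_mk (x : ProjectiveSpectrum (gr k)) (c : HomogeneousLocalization.NumDenSameDeg (gr k)
    x.asHomogeneousIdeal.toIdeal.primeCompl) :
    P1.toFrac x (HomogeneousLocalization.mk c) =
      algebraMap _ (P1.Frac k) (c.num : MvPolynomial (Fin 2) k) / algebraMap _ (P1.Frac k)
        (c.den : MvPolynomial (Fin 2) k) := by
  have hu := P1.primeCompl_isUnit x ⟨c.den, c.den_mem⟩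
  rw [eq_div_iff hu.ne_zero]
  change IsLocalization.lift (P1.primeCompl_isUnit x) (HomogeneousLocalization.mk c).val * _ = _
  rw [HomogeneousLocalization.val_mk, Localization.mk_eq_mk', mul_comm]
  exact ((IsLocalization.lift_mk'_spec (P1.primeCompl_isUnit x) _ _ _).mp rfl).symm

theorem P1.toFrac_injective (x : ProjectiveSpectrum (gr k)) : Function.Injective (P1.toFrac x) := by
  rw [injective_iff_map_eq_zero]
  intro z hz
  obtain ⟨c, rfl⟩ := HomogeneousLocalization.mk_surjective z
  have hu := P1.primeCompl_isUnit x ⟨c.den, c.den_mem⟩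
  rw [P1.toFrac_mk, div_eq_zero_iff, or_iff_left hu.ne_zero] at hz
  have h0 : (c.num : MvPolynomial (Fin 2) k) = 0 := by simpa using hz
  apply HomogeneousLocalization.val_injective
  rw [HomogeneousLocalization.val_mk, h0, Localization.mk_zero, HomogeneousLocalization.val_zero]

/-- The value of a section at a point, in the field of fractions of `k[x₀, x₁]`. -/
def P1.eval (V : (P1 k).Opens) (x : V) : Sec (P1.toSpec k) V →+* P1.Frac k :=
  (P1.toFrac x.1).comp (openToLocalization (gr k) V x.1 x.2).hom

theorem P1.eval_injective (V : (P1 k).Opens) (s : Sec (P1.toSpec k) V)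
    (h : ∀ x, P1.eval V x s = 0) : s = 0 := by
  apply Subtype.ext
  funext x
  exact P1.toFrac_injective x.1 ((h x).trans (map_zero _).symm)

theorem P1.eval_res {V W : (P1 k).Opens} (h : V ≤ W) (x : V) (s : Sec (P1.toSpec k) W) :
    P1.eval V x (Sec.res (P1.toSpec k) h s) = P1.eval W ⟨x.1, h x.2⟩ s := rfl

/-- A differential operator of degree `0` on `k[x₀, x₁]` acts on the sections of the structure
sheaf. -/
theorem P1.exists_section {n : ℕ} {P : Module.End k (MvPolynomial (Fin 2) k)}
    (hP : P ∈ diffOpLT k (MvPolynomial (Fin 2) k) n) (hG : ∀ d, ∀ s ∈ gr k d, P s ∈ gr k d)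
    (V : (P1 k).Opens) (s : Sec (P1.toSpec k) V) :
    ∃ s' : Sec (P1.toSpec k) V, ∀ x, P1.eval V x s' = extOp (P1.Frac k) P (P1.eval V x s) := by
  obtain ⟨hQ, hQs⟩ := extOp_spec (L := P1.Frac k) hP
  -- the action on homogeneous fractions of degree zero
  have key : ∀ (i : ℕ) (a b : gr k i), (b : MvPolynomial (Fin 2) k) ≠ 0 →
      ∃ j, ∃ c d : gr k j, (d : MvPolynomial (Fin 2) k) = (b : MvPolynomial (Fin 2) k) ^ (n + 1) ∧
        extOp (P1.Frac k) P (algebraMap _ _ (a : MvPolynomial (Fin 2) k) /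
          algebraMap _ _ (b : MvPolynomial (Fin 2) k)) =
        algebraMap _ _ (c : MvPolynomial (Fin 2) k) /
          algebraMap _ _ (d : MvPolynomial (Fin 2) k) := by
    intro i a b hb
    obtain ⟨c, hc, h⟩ := homogeneous_fraction (L := P1.Frac k) (gr k) n (extOp _ P) hQ 0
      (fun j s hs => ⟨P s, hG j s hs, hQs s⟩) i i a a.2 b b.2 hb
    have hd := SetLike.pow_mem_graded (n + 1) b.2
    refine ⟨_, ⟨c, ?_⟩, ⟨_, hd⟩, rfl, by rw [h, map_pow]⟩
    rwa [smul_eq_mul, show (n + 1) * i = i + 0 + n * i by ring]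
  have main : ∀ x : V, ∃ (W : (P1 k).Opens) (_ : x.1 ∈ W) (_ : W ≤ V) (j : ℕ) (c d : gr k j)
      (hd : ∀ y : W, (d : MvPolynomial (Fin 2) k) ∉ ProjectiveSpectrum.asHomogeneousIdeal y.1),
      ∀ y (hy : y ∈ V) (hW : y ∈ W), P1.toFrac y (HomogeneousLocalization.mk ⟨j, c, d, hd ⟨y, hW⟩⟩) =
        extOp (P1.Frac k) P (P1.eval V ⟨y, hy⟩ s) := by
    intro x
    obtain ⟨W, hxW, iW, i, a, b, hb, hs⟩ := s.2 x
    have hb0 : (b : MvPolynomial (Fin 2) k) ≠ 0 := fun h => hb ⟨x.1, hxW⟩ (h ▸ zero_mem _)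
    obtain ⟨j, c, d, hd, h⟩ := key i a b hb0
    refine ⟨W, hxW, iW.le, j, c, d, fun y hy => hb y ?_, fun y hy hW => ?_⟩
    · rw [hd] at hy
      exact (ProjectiveSpectrum.isPrime y.1).mem_of_pow_mem _ hy
    · have h1 : P1.eval V ⟨y, hy⟩ s = P1.toFrac y (HomogeneousLocalization.mk
          ⟨i, a, b, hb ⟨y, hW⟩⟩) := congrArg (P1.toFrac y) (hs ⟨y, hW⟩)
      exact (P1.toFrac_mk y _).trans (h.symm.trans (congrArg (extOp (P1.Frac k) P)
        (h1.trans (P1.toFrac_mk y _)).symm))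
  have ex : ∀ x : V, ∃ z : P1.At k x.1, P1.toFrac x.1 z =
      extOp (P1.Frac k) P (P1.eval V x s) := fun x => by
    obtain ⟨W, hxW, _, j, c, d, hd, h⟩ := main x
    exact ⟨_, h x.1 x.2 hxW⟩
  choose z hz using ex
  refine ⟨⟨z, fun x => ?_⟩, hz⟩
  obtain ⟨W, hxW, hWV, j, c, d, hd, h⟩ := main x
  refine ⟨W, hxW, homOfLE hWV, j, c, d, hd, fun y => ?_⟩
  apply P1.toFrac_injective y.1
  exact (hz ⟨y.1, hWV y.2⟩).trans (h y.1 (hWV y.2) y.2).symm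

end P1

/-! ### The morphisms `ρ` and `ρ_m` -/

section Rho

variable (p : ℕ) [Fact p.Prime]

/-- The endomorphism of the structure sheaf of the projective line attached to a distribution. -/
theorem exists_rho (μ : Dist (ZMod p) (SL2Ring (ZMod p))) :
    ∃ P : sheafEnd (P1.toSpec (ZMod p)) ⊤, ∀ V x s, P1.eval V.1 x (P.1 V s) =
      extOp (P1.Frac (ZMod p)) (act μ.1) (P1.eval V.1 x s) := by
  obtain ⟨n, hn⟩ := μ.2
  have h := fun V s => P1.exists_section (act_mem hn) (act_homogeneous μ.1) V s
  choose Q hQ using h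
  have inj : ∀ V (s s' : Sec (P1.toSpec (ZMod p)) V), (∀ x, P1.eval V x s = P1.eval V x s') →
      s = s' := fun V s s' h => sub_eq_zero.mp (P1.eval_injective V _ fun x => by
    rw [map_sub, h, sub_self])
  refine ⟨⟨fun V => AddMonoidHom.toZModLinearMap p
    { toFun := Q V.1
      map_zero' := inj _ _ _ fun x => by rw [hQ, map_zero, map_zero]
      map_add' := fun s t => inj _ _ _ fun x => by
        rw [hQ, map_add, map_add, map_add, hQ, hQ] }, fun V W hVW s => ?_⟩, fun V x s => hQ _ _ _⟩
  refine inj _ _ _ fun x => ?_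
  rw [P1.eval_res]
  exact (hQ W.1 s ⟨x.1, hVW x.2⟩).trans (hQ V.1 (Sec.res (P1.toSpec (ZMod p)) hVW s) x).symm

theorem sheafEnd_ext {U : (P1 (ZMod p)).Opens} {P P' : sheafEnd (P1.toSpec (ZMod p)) U}
    (h : ∀ V x s, P1.eval V.1 x (P.1 V s) = P1.eval V.1 x (P'.1 V s)) : P = P' := by
  apply Subtype.ext
  funext V
  refine LinearMap.ext fun s => sub_eq_zero.mp (P1.eval_injective _ _ fun x => ?_)
  rw [map_sub, h, sub_self]

/-- The endomorphism of the structure sheaf of the projective line attached to a distribution `μ`: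
on homogeneous fractions `a / b`, it is the extension of the action of `μ` on `k[x₀, x₁]`. -/
def rhoFun (μ : Dist (ZMod p) (SL2Ring (ZMod p))) : sheafEnd (P1.toSpec (ZMod p)) ⊤ :=
  (exists_rho p μ).choose

theorem rhoFun_spec (μ : Dist (ZMod p) (SL2Ring (ZMod p)))
    (V : {V : (P1 (ZMod p)).Opens // V ≤ ⊤}) (x : V.1) (s : Sec (P1.toSpec (ZMod p)) V.1) :
    P1.eval V.1 x ((rhoFun p μ).1 V s) =
      extOp (P1.Frac (ZMod p)) (act μ.1) (P1.eval V.1 x s) :=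
  (exists_rho p μ).choose_spec V x s

theorem rhoFun_add (μ ν : Dist (ZMod p) (SL2Ring (ZMod p))) :
    rhoFun p (μ + ν) = rhoFun p μ + rhoFun p ν := by
  refine sheafEnd_ext p fun V x s => ?_
  obtain ⟨n, hn⟩ := μ.2
  obtain ⟨m, hm⟩ := ν.2
  obtain ⟨l, hl⟩ := (μ + ν).2
  have : extOp (P1.Frac (ZMod p)) (act (μ + ν).1) = extOp _ (act μ.1) + extOp _ (act ν.1) :=
    eq_of_agree (S := MvPolynomial (Fin 2) (ZMod p)) (extOp_spec (act_mem hl)).1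
      (add_mem (diffOpLT_mono (le_max_left (n + 1) (m + 1)) (extOp_spec (act_mem hn)).1)
        (diffOpLT_mono (le_max_right (n + 1) (m + 1)) (extOp_spec (act_mem hm)).1)) fun s => by
      rw [LinearMap.add_apply, (extOp_spec (act_mem hn)).2, (extOp_spec (act_mem hm)).2,
        (extOp_spec (act_mem hl)).2, ← map_add]
      exact congrArg _ (DFunLike.congr_fun (act_add μ.1 ν.1) s)
  rw [rhoFun_spec, this]
  change _ = P1.eval V.1 x ((rhoFun p μ).1 V s + (rhoFun p ν).1 V s)
  rw [map_add, rhoFun_spec, rhoFun_spec]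
  rfl

theorem rhoFun_mul (μ ν : Dist (ZMod p) (SL2Ring (ZMod p))) :
    rhoFun p (μ * ν) = rhoFun p μ * rhoFun p ν := by
  refine sheafEnd_ext p fun V x s => ?_
  obtain ⟨n, hn⟩ := μ.2
  obtain ⟨m, hm⟩ := ν.2
  obtain ⟨l, hl⟩ := (μ * ν).2
  have : extOp (P1.Frac (ZMod p)) (act (μ * ν).1) = extOp _ (act μ.1) * extOp _ (act ν.1) :=
    eq_of_agree (S := MvPolynomial (Fin 2) (ZMod p)) (extOp_spec (act_mem hl)).1
      (mul_mem_diffOpLT _ (n + 1) (m + 1) rfl (extOp_spec (act_mem hn)).1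
        (extOp_spec (act_mem hm)).1) fun s => by
      rw [Module.End.mul_apply, (extOp_spec (act_mem hm)).2, (extOp_spec (act_mem hn)).2,
        (extOp_spec (act_mem hl)).2]
      exact congrArg _ (DFunLike.congr_fun (act_mul μ.1 ν.1) s)
  rw [rhoFun_spec, this]
  change _ = P1.eval V.1 x ((rhoFun p μ).1 V ((rhoFun p ν).1 V s))
  rw [rhoFun_spec, rhoFun_spec]
  rfl

theorem rhoFun_one : rhoFun p 1 = 1 := by
  refine sheafEnd_ext p fun V x s => ?_
  obtain ⟨l, hl⟩ := (1 : Dist (ZMod p) (SL2Ring (ZMod p))).2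
  have h1 : (1 : Module.End (ZMod p) (P1.Frac (ZMod p))) ∈ diffOpLT _ _ 1 := fun a => by
    rw [one_mul, mul_one, sub_self]
    exact zero_mem _
  have : extOp (P1.Frac (ZMod p)) (act (1 : Dist (ZMod p) (SL2Ring (ZMod p))).1) = 1 :=
    eq_of_agree (S := MvPolynomial (Fin 2) (ZMod p)) (extOp_spec (act_mem hl)).1 h1 fun s => by
      rw [(extOp_spec (act_mem hl)).2]
      exact congrArg _ (DFunLike.congr_fun act_one s)
  rw [rhoFun_spec, this]
  rfl

theorem rhoFun_zero : rhoFun p 0 = 0 := by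
  have := rhoFun_add p 0 0
  rwa [add_zero, left_eq_add] at this

theorem rhoFun_natCast (c : ℕ) : rhoFun p c = c := by
  induction c with
  | zero => rw [Nat.cast_zero, Nat.cast_zero, rhoFun_zero]
  | succ c ih => rw [Nat.cast_succ, Nat.cast_succ, rhoFun_add, ih, rhoFun_one]

theorem rhoFun_algebraMap (c : ZMod p) : rhoFun p (algebraMap _ _ c) = algebraMap _ _ c := by
  obtain ⟨c, rfl⟩ := ZMod.natCast_zmod_surjective c
  rw [map_natCast, map_natCast, rhoFun_natCast]

/-- The canonical morphism `ρ` from the distributions of `SL₂` to the differential operators on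
the projective line `P(V)`, for the action of `SL₂` on the standard representation `V`. -/
def rho : Dist (ZMod p) (SL2Ring (ZMod p)) →ₐ[ZMod p] sheafEnd (P1.toSpec (ZMod p)) ⊤ where
  toFun := rhoFun p
  map_one' := rhoFun_one p
  map_mul' := rhoFun_mul p
  map_zero' := rhoFun_zero p
  map_add' := rhoFun_add p
  commutes' := rhoFun_algebraMap p

theorem rho_mem (n : ℕ) (μ : Dist (ZMod p) (SL2Ring (ZMod p)))
    (hμ : μ ∈ distFil (ZMod p) (SL2Ring (ZMod p)) n) :
    rho p μ ∈ diffOps (P1.toSpec (ZMod p)) n ⊤ := fun V =>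
  mem_diffOpLT_of_injective (P1.eval V.1) (P1.eval_injective V.1) (n + 1) _
    (fun _ => extOp (P1.Frac (ZMod p)) (act μ.1)) (fun _ => (extOp_spec (act_mem hμ)).1)
    (fun x s => rhoFun_spec p μ V x s)

/-- The algebra `U^{(m)}` of level `m` of `SL₂`. -/
abbrev U (m : ℕ) : Type := LevelAlg (p ^ m) (distFil (ZMod p) (SL2Ring (ZMod p)))

/-- The algebra `H⁰(P¹, D^{(m)})`. -/
abbrev H0 (m : ℕ) : AlgCat.{0} (ZMod p) := levelGlobal (P1.toSpec (ZMod p)) (p ^ m)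

/-- The canonical morphism `ρ_m : U^{(m)} → H⁰(P¹, D^{(m)})` induced by `ρ`. -/
def rhoLevel (m : ℕ) : U p m →ₐ[ZMod p] H0 p m :=
  (levelToGlobal (P1.toSpec (ZMod p)) (p ^ m)).comp (LevelAlg.map (p ^ m) (rho p) (rho_mem p))

/-- The norm element `Δ_T` in `U^{(m)}`, for `m > 0`. -/
def deltaLevel (m : ℕ) (hm : 0 < m) : U p m := LevelAlg.of (p ^ m) _ ⟨deltaT p, deltaT_mem_level p hm⟩

end Rho

/-! ### The Dwork operator -/

section Dwork

/-- The standard affine chart `D₊(x_i)` of the projective line. -/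
def chart (k : Type) [Field k] (i : Fin 2) : (P1 k).Opens :=
  Proj.basicOpen (gr k) (MvPolynomial.X i)

/-- The coordinate on the chart `D₊(x_i)`: `x₁ / x₀` for `i = 0` and `x₀ / x₁` for `i = 1`. -/
def coord (k : Type) [Field k] (i : Fin 2) : Sec (P1.toSpec k) (chart k i) :=
  (Proj.awayToSection (gr k) (MvPolynomial.X i)).hom
    (HomogeneousLocalization.Away.mk (gr k) (f := MvPolynomial.X i) (d := 1)
      (MvPolynomial.isHomogeneous_X k i) 1 (MvPolynomial.X i.rev)
      (by simpa using MvPolynomial.isHomogeneous_X k i.rev))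

/-- The section `f(t_i)` of the structure sheaf on the chart `D₊(x_i)` with coordinate `t_i`. -/
def chartSec (k : Type) [Field k] (i : Fin 2) (f : k[X]) : Sec (P1.toSpec k) (chart k i) :=
  Polynomial.aeval (coord k i) f

variable (p : ℕ) [Fact p.Prime]

/-- The trace of the lift of the Frobenius `t ↦ t ^ p` of the affine line over `ℤ_p`: the trace of
`ℤ_p[t]` as an algebra over itself through `t ↦ t ^ p`. On each standard chart this is the trace of
the lift `[x₀ : x₁] ↦ [x₀ ^ p : x₁ ^ p]` of the Frobenius of the projective line. -/
def frobTrace (f : ℤ_[p][X]) : ℤ_[p][X] :=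
  @Algebra.trace ℤ_[p][X] ℤ_[p][X] _ _ (Polynomial.expand ℤ_[p] p).toRingHom.toAlgebra f

/-- `P` is the Dwork operator: in the charts, `P` is the reduction modulo `p` of
`f ↦ F^* (Tr_F(f) / p)`, for the lift `[x₀ : x₁] ↦ [x₀ ^ p : x₁ ^ p]` of the Frobenius; modulo `p`,
`F^*` is `g ↦ g ^ p`. -/
def IsDworkOperator (P : sheafEnd (P1.toSpec (ZMod p)) ⊤) : Prop :=
  ∀ (i : Fin 2) (f g : ℤ_[p][X]), frobTrace p f = (p : ℤ_[p][X]) * g →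
    P.1 ⟨chart (ZMod p) i, le_top⟩ (chartSec (ZMod p) i (f.map PadicInt.toZMod)) =
      chartSec (ZMod p) i (g.map PadicInt.toZMod) ^ p

theorem diffOps_mono {X : Scheme.{0}} {k : Type} [CommRing k] (f : X ⟶ Spec (.of k))
    (U : X.Opens) : Monotone fun n => diffOps f n U :=
  fun _ _ h _ hP V => diffOpLT_mono (Nat.succ_le_succ h) (hP V)

theorem dwork_le {m : ℕ} (hm : 0 < m) : p - 1 ≤ 2 * p ^ m - 1 := by
  have := Nat.le_self_pow hm.ne' p
  omega

/-- The class in `H⁰(P¹, D^{(m)})`, for `m > 0`, of a global differential operator of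
order `≤ p - 1`. -/
def opLevel (m : ℕ) (hm : 0 < m) (P : diffOps (P1.toSpec (ZMod p)) (p - 1) ⊤) : H0 p m :=
  levelToGlobal (P1.toSpec (ZMod p)) (p ^ m)
    (LevelAlg.of (p ^ m) _ ⟨P.1, diffOps_mono _ ⊤ (dwork_le p hm) P.2⟩)

end Dwork

end ArithDiff

end

open ArithDiff

/-! Both operators are diagonal in the monomial basis of each chart, with the same eigenvalues.

On the Dwork side, `R[X]` is free over itself through `X ↦ X ^ p`, with basis `1, X, …, X ^ (p -
1)`, and every diagonal entry of multiplication by `f` is the part of `f` in degrees divisible by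
`p`, contracted. Hence `Tr_F(f) / p = contract p f`, and composing with `F^*` gives the projector
onto the span of the `t ^ n` with `p ∣ n` (`trace_expand`, `isDworkOperator_iff`).

On the group side, `H` acts on `k[x₀, x₁]` as the derivation with weights `1, -1` on `x₀, x₁`, so `t
^ n` is an eigenvector with eigenvalue `-2n` or `2n` according to the chart (`rho_elemH_coord_pow`).
For `c` in `𝔽_p`, the sum of `(-1) ^ i binom(c, i)` over `i < p` is `1` if `c = 0` and `0`
otherwise, by the binomial theorem applied to the representative of `c` in `[0, p)`
(`sum_eval_descPochhammer`). Thus `Δ_T` fixes `t ^ n` when `p ∣ 2n` and kills it otherwise; as `p`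
is odd, this is the Dwork projector. The same sum at `c = n` gives the formula in the charts, since
`(-t) ^ r ∂^[r]` multiplies `t ^ n` by `(-1) ^ r binom(n, r)`.

Existence follows with `P = ρ(Δ_T)`, of order `≤ p - 1` because `Δ_T` is a polynomial of degree at
most `p - 1` in `H`, which has order `≤ 1`. Uniqueness holds because a differential operator is
determined by its values on polynomials in the coordinates (`eq_zero_of_chartSec_eq_zero`). The
statement at level `m` is then functoriality. -/

noncomputable section

open Polynomial

namespace ArithDiff

/-! ### The trace along `X ↦ X ^ p` -/

section Trace

variable {R : Type} [CommRing R]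

/-- The part of a polynomial supported in degrees `≡ i` modulo `p`. -/
def contractAt (p i : ℕ) (f : R[X]) : R[X] := contract p (divX^[i] f)

theorem coeff_iterate_divX (i n : ℕ) (f : R[X]) : (divX^[i] f).coeff n = f.coeff (n + i) := by
  induction i generalizing n with
  | zero => rfl
  | succ i ih => rw [Function.iterate_succ_apply', coeff_divX, ih, add_right_comm, add_assoc]

theorem coeff_contractAt {p : ℕ} (hp : p ≠ 0) (i n : ℕ) (f : R[X]) :
    (contractAt p i f).coeff n = f.coeff (n * p + i) := by
  rw [contractAt, coeff_contract hp, coeff_iterate_divX]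

/-- The two shifts by `i` cancel. This is why all diagonal entries of multiplication by `f`
coincide. -/
theorem contractAt_mul_X_pow {p : ℕ} (hp : p ≠ 0) (i : ℕ) (f : R[X]) :
    contractAt p i (f * X ^ i) = contract p f := by
  ext n
  rw [coeff_contractAt hp, coeff_mul_X_pow, coeff_contract hp]

/-- The left factor lives in degrees divisible by `p`, and `i, j < p`, so uniqueness of the
remainder modulo `p` forces `i = j`. -/
theorem coeff_expand_mul_X_pow {p : ℕ} (hp : p ≠ 0) (g : R[X]) (i j : Fin p) (n : ℕ) :
    (expand R p g * X ^ (i : ℕ)).coeff (n * p + j) = if i = j then g.coeff n else 0 := by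
  have hp' : 0 < p := Nat.pos_of_ne_zero hp
  split_ifs with h
  · rw [h, coeff_mul_X_pow, coeff_expand_mul hp']
  · rw [coeff_mul_X_pow', coeff_expand hp']
    split_ifs with h1 h2
    · exfalso
      obtain ⟨q, hq⟩ := h2
      have h3 : n * p + j = q * p + i := by rw [mul_comm q]; omega
      have h4 := congrArg (· % p) h3
      simp only [Nat.mul_comm n, Nat.mul_comm q, Nat.mul_add_mod,
        Nat.mod_eq_of_lt i.2, Nat.mod_eq_of_lt j.2] at h4
      exact h (Fin.ext h4.symm)
    · rfl
    · rfl

/-- Together with `contractAt_sum`, this says that the powers `X ^ i`, `i < p`, form a basis: here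
they span, there the coordinates are unique. -/
theorem sum_expand_contractAt {p : ℕ} (hp : p ≠ 0) (f : R[X]) :
    ∑ i : Fin p, expand R p (contractAt p i f) * X ^ (i : ℕ) = f := by
  ext n
  obtain ⟨m, j, rfl⟩ : ∃ (m : ℕ) (j : Fin p), n = m * p + j :=
    ⟨n / p, ⟨n % p, Nat.mod_lt n (Nat.pos_of_ne_zero hp)⟩, (Nat.div_add_mod' n p).symm⟩
  simp [finsetSum_coeff, coeff_expand_mul_X_pow hp, coeff_contractAt hp]

theorem contractAt_sum {p : ℕ} (hp : p ≠ 0) (g : Fin p → R[X]) (j : Fin p) :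
    contractAt p j (∑ i : Fin p, expand R p (g i) * X ^ (i : ℕ)) = g j := by
  ext n
  rw [coeff_contractAt hp, finsetSum_coeff]
  simp [coeff_expand_mul_X_pow hp]

variable {A : Type} [CommRing A] [Algebra A R[X]]

/-- The coordinates in the basis `1, X, …, X ^ (p - 1)` of `R[X]` as a module over `A`, where
`A ≃ R[X]` acts through `X ↦ X ^ p`. -/
def expandEquiv {p : ℕ} (hp : p ≠ 0) (e : A ≃+* R[X])
    (he : ∀ a, algebraMap A R[X] a = expand R p (e a)) : R[X] ≃ₗ[A] (Fin p → A) :=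
  LinearEquiv.symm
  { toFun := fun g => ∑ i : Fin p, expand R p (e (g i)) * X ^ (i : ℕ)
    map_add' := fun g h => by simp [add_mul, Finset.sum_add_distrib]
    map_smul' := fun c g => by simp [Algebra.smul_def, he, Finset.mul_sum, mul_assoc]
    invFun := fun f i => e.symm (contractAt p i f)
    left_inv := fun g => funext fun j =>
      (congrArg e.symm (contractAt_sum hp (fun i => e (g i)) j)).trans (e.symm_apply_apply _)
    right_inv := fun f => by simpa using sum_expand_contractAt hp f }

/-- The scalars form a separate type `A ≃ R[X]`, so that the module structure through `X ↦ X ^ p`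
does not compete with that of `R[X]` over itself. -/
theorem trace_of_algebraMap_eq_expand {p : ℕ} (hp : p ≠ 0) (e : A ≃+* R[X])
    (he : ∀ a, algebraMap A R[X] a = expand R p (e a)) (f : R[X]) :
    Algebra.trace A R[X] f = (p : A) * e.symm (contract p f) := by
  let b : Module.Basis (Fin p) A R[X] := Module.Basis.ofEquivFun (expandEquiv hp e he)
  have hb : ∀ i, b i = X ^ (i : ℕ) := fun i => by
    rw [Module.Basis.coe_ofEquivFun]
    change ∑ j : Fin p, expand R p (e ((Pi.single i 1 : Fin p → A) j)) * X ^ (j : ℕ) = _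
    rw [Finset.sum_eq_single i (fun j _ hj => by simp [Pi.single_eq_of_ne hj]) (by simp)]
    simp
  rw [Algebra.trace_eq_matrix_trace b, Matrix.trace]
  -- The `i`-th diagonal entry is the `i`-th coordinate of `f X ^ i`, which does not depend on `i`;
  -- the `p` equal entries produce the factor `p`.
  have : ∀ i, Matrix.diag (Algebra.leftMulMatrix b f) i = e.symm (contract p f) := fun i => by
    rw [Matrix.diag_apply, Algebra.leftMulMatrix_eq_repr_mul, hb]
    change e.symm (contractAt p i (f * X ^ (i : ℕ))) = _
    rw [contractAt_mul_X_pow hp]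
  rw [Finset.sum_congr rfl fun i _ => this i]
  simp

/-- The trace of `R[X]` over itself through `X ↦ X ^ p`. -/
theorem trace_expand {p : ℕ} (hp : p ≠ 0) (f : R[X]) :
    @Algebra.trace R[X] R[X] _ _ (expand R p).toRingHom.toAlgebra f = (p : R[X]) * contract p f :=
  @trace_of_algebraMap_eq_expand R _ R[X] _ (expand R p).toRingHom.toAlgebra p hp
    (RingEquiv.refl _) (fun _ => rfl) f

theorem map_contract' {S : Type} [CommRing S] (φ : R →+* S) {p : ℕ} (hp : p ≠ 0) (f : R[X]) :
    (contract p f).map φ = contract p (f.map φ) := by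
  ext n
  simp [coeff_contract hp]

end Trace

/-! ### The Dwork operator modulo `p` and alternating binomial sums -/

section Dwork

variable (p : ℕ) [Fact p.Prime]

/-- Frobenius fixes the coefficients in `𝔽_p`, so `g(t) ^ p = g(t ^ p)`. -/
theorem chartSec_pow_char (i : Fin 2) (g : (ZMod p)[X]) :
    chartSec (ZMod p) i g ^ p = chartSec (ZMod p) i (expand (ZMod p) p g) := by
  rw [ZMod.expand_card]
  exact (map_pow (aeval (coord (ZMod p) i)) g p).symm

/-- Removes `ℤ_p` from the definition. The trace formula makes `Tr_F(f) / p` equal to `contract p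
f`, which commutes with reduction. Forwards, a polynomial over `𝔽_p` is lifted to `ℤ_p`; backwards,
`p` is cancelled in the domain `ℤ_p[X]`. -/
theorem isDworkOperator_iff (P : sheafEnd (P1.toSpec (ZMod p)) ⊤) : IsDworkOperator p P ↔
    ∀ (i : Fin 2) (f : (ZMod p)[X]), P.1 ⟨chart (ZMod p) i, le_top⟩ (chartSec (ZMod p) i f) =
      chartSec (ZMod p) i (expand (ZMod p) p (contract p f)) := by
  have hp : p ≠ 0 := (Fact.out : p.Prime).ne_zero
  constructor
  · intro h i f
    obtain ⟨f, rfl⟩ := map_surjective _ (ZMod.ringHom_surjective (PadicInt.toZMod (p := p))) f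
    rw [h i f (contract p f) (trace_expand hp f), chartSec_pow_char, map_contract' _ hp]
  · intro h i f g hfg
    have : contract p f = g := by
      rw [frobTrace, trace_expand hp] at hfg
      exact mul_left_cancel₀ (by exact_mod_cast hp) hfg
    rw [h, ← this, chartSec_pow_char, map_contract' _ hp]

theorem expand_contract_X_pow (n : ℕ) : expand (ZMod p) p (contract p (X ^ n)) =
    if (n : ZMod p) = 0 then (X ^ n : (ZMod p)[X]) else 0 := by
  have hp : p ≠ 0 := (Fact.out : p.Prime).ne_zero
  ext m
  simp only [coeff_expand hp.bot_lt, coeff_contract hp, ZMod.natCast_eq_zero_iff]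
  split_ifs with h1 h2 h2
  · rw [Nat.div_mul_cancel h1]
  · rw [Nat.div_mul_cancel h1, coeff_X_pow, if_neg (by rintro rfl; exact h2 h1), coeff_zero]
  · rw [coeff_X_pow, if_neg (by rintro rfl; exact h1 h2)]
  · rw [coeff_zero]

/-- For `i < p` the factorial `i!` is invertible modulo `p`. In particular `binom(n, i)` modulo `p`
depends only on `n` modulo `p`. -/
theorem eval_descPochhammer_natCast (i n : ℕ) (hi : i < p) :
    ((i.factorial : ZMod p)⁻¹) * (descPochhammer (ZMod p) i).eval (n : ZMod p) =
      (n.choose i : ZMod p) := by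
  have : (i.factorial : ZMod p) ≠ 0 := by
    rw [Ne, ZMod.natCast_eq_zero_iff, (Fact.out : p.Prime).dvd_factorial]
    omega
  rw [descPochhammer_eval_eq_descFactorial, Nat.descFactorial_eq_factorial_mul_choose,
    Nat.cast_mul, inv_mul_cancel_left₀ this]

/-- With `c` represented by `c.val < p`, the sum contains the whole row `c.val` of Pascal's
triangle, and its other terms vanish. The alternating sum of a row is `(1 - 1) ^ c.val`. -/
theorem sum_eval_descPochhammer (c : ZMod p) : ∑ i ∈ Finset.range p, (-1 : ZMod p) ^ i *
    ((i.factorial : ZMod p)⁻¹ * (descPochhammer (ZMod p) i).eval c) = if c = 0 then 1 else 0 := by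
  have hc : ((c.val : ℕ) : ZMod p) = c := ZMod.natCast_zmod_val c
  have h1 : ∑ i ∈ Finset.range p, (-1 : ZMod p) ^ i *
      ((i.factorial : ZMod p)⁻¹ * (descPochhammer (ZMod p) i).eval c) =
      ∑ i ∈ Finset.range p, (-1 : ZMod p) ^ i * (c.val.choose i : ZMod p) :=
    Finset.sum_congr rfl fun i hi => by
      rw [← hc, eval_descPochhammer_natCast p _ _ (Finset.mem_range.mp hi), hc]
  rw [h1, ← Finset.sum_subset (s₁ := Finset.range (c.val + 1))
    (Finset.range_subset_range.mpr (ZMod.val_lt c)) fun i _ hi => by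
      rw [Nat.choose_eq_zero_of_lt (by simpa using hi), Nat.cast_zero, mul_zero]]
  have h2 := congrArg (Int.cast : ℤ → ZMod p) (Int.alternating_sum_range_choose (n := c.val))
  push_cast at h2
  rw [h2]
  simp only [ZMod.val_eq_zero]

theorem sum_choose_natCast (n : ℕ) : ∑ i ∈ Finset.range p, (-1 : ZMod p) ^ i *
    (n.choose i : ZMod p) = if (n : ZMod p) = 0 then 1 else 0 := by
  rw [← sum_eval_descPochhammer]
  exact Finset.sum_congr rfl fun i hi => by
    rw [eval_descPochhammer_natCast p _ _ (Finset.mem_range.mp hi)]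

end Dwork

/-! ### Commutator arguments and orders of operators -/

section Operators

variable {k A : Type} [CommRing k] [CommRing A] [Algebra k A]

/-- A differential operator of order `≤ 1` which kills constants is a derivation. -/
theorem leibniz_of_mem_diffOpLT {Q : Module.End k A} (hQ : Q ∈ diffOpLT k A 2) (h1 : Q 1 = 0)
    (a b : A) : Q (a * b) = a * Q b + b * Q a := by
  -- The index of `diffOpLT` bounds the order strictly, so two commutators bring index `2` down to
  -- `0`, where the only operator is zero. Evaluating `[[Q, a], b]` at `1` gives the Leibniz rule.
  have h := LinearMap.congr_fun
    (show _ = (0 : Module.End k A) from hQ a b) 1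
  simp only [LinearMap.sub_apply, Module.End.mul_apply, LinearMap.mulLeft_apply, mul_one,
    LinearMap.zero_apply, h1, mul_zero, sub_zero] at h
  linear_combination h

/-- A differential operator which vanishes on the image of a ring homomorphism vanishes on the
fractions of elements of this image. -/
theorem apply_eq_zero_of_comp_eq_zero {B : Type} [CommRing B] (φ : B →+* A) {a b : B} {s : A}
    (hb : ∀ z, φ b * z = 0 → z = 0) (hs : φ b * s = φ a) (n : ℕ) :
    ∀ Q ∈ diffOpLT k A n, (∀ x, Q (φ x) = 0) → Q s = 0 := by
  induction n with
  | zero =>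
    intro Q hQ _
    rw [show Q = 0 from hQ]
    rfl
  | succ n ih =>
    intro Q hQ h
    -- The commutator of `Q` with `φ b` has smaller order and still kills the image of `φ`. Hence `Q
    -- (φ b * s) = φ b * Q s`; the left side is `Q (φ a) = 0`, and `φ b` is not a zero divisor.
    have h1 := ih _ (hQ (φ b)) fun x => by simp [← map_mul, h]
    refine hb _ ?_
    simpa [hs, h] using h1

variable {X : AlgebraicGeometry.Scheme.{0}} (f : X ⟶ AlgebraicGeometry.Spec (.of k))

theorem mul_mem_diffOps {U : X.Opens} {n m : ℕ} {P Q : sheafEnd f U} (hP : P ∈ diffOps f n U)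
    (hQ : Q ∈ diffOps f m U) : P * Q ∈ diffOps f (n + m) U := fun V => by
  have := mul_mem_diffOpLT _ (n + 1) (m + 1) rfl (hP V) (hQ V)
  rwa [show n + 1 + (m + 1) - 1 = n + m + 1 by omega] at this

theorem pow_mem_diffOps {U : X.Opens} {P : sheafEnd f U} (hP : P ∈ diffOps f 1 U) (n : ℕ) :
    P ^ n ∈ diffOps f n U := by
  induction n with
  | zero =>
    rw [pow_zero]
    intro V a
    change (1 : Module.End k _) * _ - _ * 1 ∈ _
    rw [one_mul, mul_one, sub_self]
    exact zero_mem _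
  | succ n ih =>
    rw [pow_succ]
    exact mul_mem_diffOps f ih hP

/-- Orders add under composition, so a polynomial in an operator of order `≤ 1` has order at most
its degree. This yields the bound `p - 1` for the image of `Δ_T`. -/
theorem aeval_mem_diffOps {U : X.Opens} {P : sheafEnd f U} (hP : P ∈ diffOps f 1 U) {n : ℕ}
    {q : k[X]} (hq : q.natDegree ≤ n) : aeval P q ∈ diffOps f n U := by
  rw [aeval_eq_sum_range]
  refine Submodule.sum_mem _ fun j hj => Submodule.smul_mem _ _ ?_
  exact diffOps_mono f U (by have := Finset.mem_range.mp hj; omega) (pow_mem_diffOps f hP j)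

/-- Evaluation of endomorphisms of the structure sheaf on an open set. -/
def sheafEndEval {U : X.Opens} (V : {V : X.Opens // V ≤ U}) :
    sheafEnd f U →ₐ[k] Module.End k (Sec f V.1) :=
  (Pi.evalAlgHom k _ V).comp (sheafEnd f U).val

end Operators

/-! ### Weights of `H` and homogeneous fractions in the charts -/

section Weight

variable (k : Type) [Field k]

/-- The weights `1, -1` of `H` on `x₀, x₁`. -/
def weightH (i : Fin 2) : k := ![1, -1] i

theorem distH_gen (i j : Fin 2) :
    (SL2Ring.distH k).ofConv (SL2Ring.gen k i j) = if i = j then weightH k j else 0 := by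
  change TrivSqZeroExt.snd (SL2Ring.pointH k (SL2Ring.gen k i j)) = _
  rw [SL2Ring.pointH, SL2Ring.lift_gen]
  fin_cases i <;> fin_cases j <;> simp [weightH]

theorem act_distH_X (j : Fin 2) :
    act (SL2Ring.distH k) (MvPolynomial.X j) = weightH k j • MvPolynomial.X j := by
  change actFun _ _ (coaction k _) = _
  rw [coaction, MvPolynomial.aeval_X, map_sum]
  simp [actFun_tmul, distH_gen, ite_smul]

theorem act_distH_one : act (SL2Ring.distH k) 1 = 0 := by
  change actFun _ _ (coaction k _) = _
  rw [map_one, Algebra.TensorProduct.one_def, actFun_tmul]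
  change TrivSqZeroExt.snd (SL2Ring.pointH k 1) • (1 : MvPolynomial (Fin 2) k) = 0
  rw [map_one, TrivSqZeroExt.snd_one, zero_smul]

/-- The weight of `H` on the coordinate `t_i`. -/
def weightCoord (i : Fin 2) : k := weightH k i.rev - weightH k i

/-- The coordinate `t_i` as an element of the field of fractions of `k[x₀, x₁]`. -/
def fracCoord (i : Fin 2) : P1.Frac k :=
  algebraMap (MvPolynomial (Fin 2) k) _ (MvPolynomial.X i.rev) /
    algebraMap (MvPolynomial (Fin 2) k) _ (MvPolynomial.X i)

theorem algebraMap_X_ne_zero (i : Fin 2) :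
    algebraMap (MvPolynomial (Fin 2) k) (P1.Frac k) (MvPolynomial.X i) ≠ 0 := by
  simp

/-- `H` is a distribution of order `≤ 1` whose action kills constants, so its extension to the field
of fractions is a derivation. -/
theorem extOp_distH_mul (a b : P1.Frac k) : extOp (P1.Frac k) (act (SL2Ring.distH k)) (a * b) =
    a * extOp (P1.Frac k) (act (SL2Ring.distH k)) b +
      b * extOp (P1.Frac k) (act (SL2Ring.distH k)) a := by
  obtain ⟨h, h'⟩ := extOp_spec (L := P1.Frac k) (act_mem (SL2Ring.distH_mem k))
  refine leibniz_of_mem_diffOpLT h ?_ a b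
  rw [← map_one (algebraMap (MvPolynomial (Fin 2) k) _), h', act_distH_one, map_zero]

theorem extOp_distH_coord (i : Fin 2) : extOp (P1.Frac k) (act (SL2Ring.distH k)) (fracCoord k i) =
    weightCoord k i • fracCoord k i := by
  obtain ⟨-, h'⟩ := extOp_spec (L := P1.Frac k) (act_mem (SL2Ring.distH_mem k))
  have hX : ∀ j, extOp (P1.Frac k) (act (SL2Ring.distH k))
      (algebraMap (MvPolynomial (Fin 2) k) _ (MvPolynomial.X j)) =
      algebraMap k _ (weightH k j) * algebraMap (MvPolynomial (Fin 2) k) _ (MvPolynomial.X j) :=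
    fun j => by
      rw [h', act_distH_X, MvPolynomial.smul_eq_C_mul, map_mul]
      rfl
  have h0 := algebraMap_X_ne_zero k i
  -- In place of a quotient rule, the Leibniz rule is applied to the product of `x_i` and `t_i`,
  -- which is the other variable; the weight of `t_i` is then the difference of the two weights.
  have h1 := extOp_distH_mul k
    (algebraMap (MvPolynomial (Fin 2) k) _ (MvPolynomial.X i)) (fracCoord k i)
  have h2 : algebraMap (MvPolynomial (Fin 2) k) _ (MvPolynomial.X i) * fracCoord k i =
    algebraMap (MvPolynomial (Fin 2) k) _ (MvPolynomial.X i.rev) := mul_div_cancel₀ _ h0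
  rw [h2, hX, hX] at h1
  refine mul_left_cancel₀ h0 ?_
  rw [weightCoord, Algebra.smul_def, map_sub]
  linear_combination -h1 - (algebraMap k _ (weightH k i.rev)) * h2

theorem extOp_distH_coord_pow (i : Fin 2) (n : ℕ) :
    extOp (P1.Frac k) (act (SL2Ring.distH k)) (fracCoord k i ^ n) =
      (n * weightCoord k i) • fracCoord k i ^ n := by
  induction n with
  | zero =>
    obtain ⟨-, h'⟩ := extOp_spec (L := P1.Frac k) (act_mem (SL2Ring.distH_mem k))
    rw [pow_zero, ← map_one (algebraMap (MvPolynomial (Fin 2) k) _), h', act_distH_one]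
    simp
  | succ n ih =>
    rw [pow_succ, extOp_distH_mul, ih, extOp_distH_coord]
    simp only [Algebra.smul_def, map_mul, map_natCast]
    push_cast
    ring

theorem eval_coord (i : Fin 2) (V : (P1 k).Opens) (h : V ≤ chart k i) (x : V) :
    P1.eval V x (Sec.res _ h (coord k i)) = fracCoord k i := by
  have key : ∀ (y : ProjectiveSpectrum (gr k)) (hy : y ∈ chart k i),
      P1.toFrac y ((coord k i).1 ⟨y, hy⟩) = fracCoord k i := fun y hy => by
    have hy' : MvPolynomial.X i ∈ y.asHomogeneousIdeal.toIdeal.primeCompl := hy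
    -- The germ of the coordinate at `y` is the image of the fraction under localization from the
    -- powers of `x_i`; the exponents `1 • 1` and `^ 1` come from the form of `Away.mk`.
    have h1 : (coord k i).1 ⟨y, hy⟩ = HomogeneousLocalization.mapId (gr k)
      (P := Submonoid.powers (MvPolynomial.X i))
      (Q := y.asHomogeneousIdeal.toIdeal.primeCompl) (Submonoid.powers_le.mpr hy')
      (HomogeneousLocalization.mk ⟨1 • 1, ⟨MvPolynomial.X i.rev,
        by simpa using MvPolynomial.isHomogeneous_X k i.rev⟩, ⟨MvPolynomial.X i ^ 1,
        SetLike.pow_mem_graded 1 (MvPolynomial.isHomogeneous_X k i)⟩, ⟨1, rfl⟩⟩) := rfl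
    refine (congrArg (P1.toFrac y) (h1.trans (HomogeneousLocalization.map_mk _ _ _))).trans
      ((P1.toFrac_mk y _).trans ?_)
    change algebraMap (MvPolynomial (Fin 2) k) _ (MvPolynomial.X i.rev) /
      algebraMap (MvPolynomial (Fin 2) k) _ (MvPolynomial.X i ^ 1) = _
    rw [pow_one, fracCoord]
  exact key x.1 (h x.2)

/-- The points of the projective line lie in one of the standard charts. -/
theorem exists_mem_chart (x : P1 k) : ∃ i, x ∈ chart k i := by
  by_contra! h
  have hX : ∀ i, (MvPolynomial.X i : MvPolynomial (Fin 2) k) ∈ x.asHomogeneousIdeal := fun i => by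
    by_contra hi
    exact h i hi
  -- A prime containing both variables would contain the irrelevant ideal, which points of `Proj`
  -- exclude.
  apply x.not_irrelevant_le
  intro a ha
  have h1 : Ideal.span (MvPolynomial.X '' Set.univ) ≤ x.asHomogeneousIdeal.toIdeal := by
    rw [Ideal.span_le]
    rintro _ ⟨i, -, rfl⟩
    exact hX i
  -- Only the constant monomial avoids both variables, and its coefficient in `a` vanishes because
  -- the degree `0` component of `a` does.
  refine h1 (MvPolynomial.mem_ideal_span_X_image.mpr fun m hm => ?_)
  by_contra! hm'
  have hm0 : m = 0 := by
    ext i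
    exact hm' i trivial
  rw [MvPolynomial.mem_support_iff, hm0] at hm
  have h2 : MvPolynomial.homogeneousComponent 0 a = 0 := by
    rw [← MvPolynomial.decomposition.decompose'_apply]
    exact ha
  rw [MvPolynomial.homogeneousComponent_zero] at h2
  exact hm (by simpa using h2)

/-- Dehomogenization: `x_i ↦ 1` and the other variable maps to the coordinate. -/
def dehomogenize (i : Fin 2) : MvPolynomial (Fin 2) k →ₐ[k] k[X] :=
  MvPolynomial.aeval fun j => if j = i then 1 else X

/-- Each monomial of degree `d` is `x_i ^ d` times a power of `t_i`. For `a, b` of equal degree the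
factors `x_i ^ d` cancel, so `a / b` is a quotient of polynomials in `t_i`. -/
theorem aeval_dehomogenize (i : Fin 2) {d : ℕ} {a : MvPolynomial (Fin 2) k} (ha : a ∈ gr k d) :
    aeval (fracCoord k i) (dehomogenize k i a) *
      algebraMap (MvPolynomial (Fin 2) k) _ (MvPolynomial.X i) ^ d =
    algebraMap (MvPolynomial (Fin 2) k) _ a := by
  have h0 := algebraMap_X_ne_zero k i
  have hX : ∀ j, aeval (fracCoord k i) (dehomogenize k i (MvPolynomial.X j)) *
      algebraMap (MvPolynomial (Fin 2) k) _ (MvPolynomial.X i) =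
      algebraMap (MvPolynomial (Fin 2) k) _ (MvPolynomial.X j) := fun j => by
    rw [dehomogenize, MvPolynomial.aeval_X]
    split_ifs with h
    · rw [h, map_one, one_mul]
    · rw [aeval_X, show j = i.rev by fin_cases i <;> fin_cases j <;> simp_all]
      exact div_mul_cancel₀ _ h0
  rw [← MvPolynomial.support_sum_monomial_coeff a]
  simp only [map_sum, Finset.sum_mul]
  refine Finset.sum_congr rfl fun v hv => ?_
  have hd : v 0 + v 1 = d := by
    have := ha (MvPolynomial.mem_support_iff.mp hv)
    simpa [Finsupp.weight_apply, Finsupp.sum_fintype] using this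
  generalize MvPolynomial.coeff v a = c
  rw [MvPolynomial.monomial_eq, Finsupp.prod_fintype _ _ (by simp), Fin.prod_univ_two,
    ← MvPolynomial.smul_eq_C_mul, map_smul, map_smul, Algebra.smul_def,
    MvPolynomial.smul_eq_C_mul]
  simp only [map_mul, map_pow, ← hX 0, ← hX 1, ← hd]
  rw [pow_add, mul_pow, mul_pow]
  change _ = algebraMap k (P1.Frac k) _ * _
  ring

end Weight

/-! ### Uniqueness, and the image of `Δ_T` as the Dwork projector -/

section Projector

variable (p : ℕ) [Fact p.Prime]

theorem eval_chartSec (i : Fin 2) (V : (P1 (ZMod p)).Opens) (h : V ≤ chart (ZMod p) i) (x : V)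
    (f : (ZMod p)[X]) : P1.eval V x (Sec.res _ h (chartSec (ZMod p) i f)) =
      aeval (fracCoord (ZMod p) i) f := by
  have h1 : ((P1.eval V x).comp ((Sec.res _ h : Sec (P1.toSpec (ZMod p)) (chart (ZMod p) i) →ₐ[ZMod p]
      _) : Sec (P1.toSpec (ZMod p)) (chart (ZMod p) i) →+* _)).comp
      (aeval (coord (ZMod p) i) : (ZMod p)[X] →ₐ[ZMod p] _).toRingHom =
      (aeval (fracCoord (ZMod p) i) : (ZMod p)[X] →ₐ[ZMod p] _).toRingHom := by
    -- Ring homomorphisms out of `𝔽_p` are unique, so only the image of `X` has to be compared.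
    refine Polynomial.ringHom_ext' (Subsingleton.elim _ _) ?_
    simpa using eval_coord (ZMod p) i V h x
  exact RingHom.congr_fun h1 f

/-- Near any point a section is a quotient of two polynomials in the coordinate of a chart, and a
differential operator that kills the polynomials kills such quotients. -/
theorem eq_zero_of_chartSec_eq_zero {n : ℕ} {Q : sheafEnd (P1.toSpec (ZMod p)) ⊤}
    (hQ : Q ∈ diffOps (P1.toSpec (ZMod p)) n ⊤)
    (h : ∀ i f, Q.1 ⟨chart (ZMod p) i, le_top⟩ (chartSec (ZMod p) i f) = 0) : Q = 0 := by
  refine sheafEnd_ext p fun V x s => ?_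
  obtain ⟨i, hxi⟩ := exists_mem_chart (ZMod p) x.1
  obtain ⟨W, hxW, hWV, d, a, b, hb, hs⟩ := s.2 x
  -- On this neighbourhood of `x` the section is a single fraction `a / b` and the coordinate `t_i`
  -- is defined.
  let W' : (P1 (ZMod p)).Opens := W ⊓ chart (ZMod p) i
  have hW'V : W' ≤ V.1 := inf_le_left.trans hWV.le
  have hW'i : W' ≤ chart (ZMod p) i := inf_le_right
  let φ : (ZMod p)[X] →+* Sec (P1.toSpec (ZMod p)) W' :=
    ((Sec.res _ hW'i).comp (aeval (coord (ZMod p) i))).toRingHom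
  have hφ : ∀ (y : W') f, P1.eval W' y (φ f) = aeval (fracCoord (ZMod p) i) f := fun y f =>
    eval_chartSec p i W' hW'i y f
  have h0 := algebraMap_X_ne_zero (ZMod p) i
  have hb0 : algebraMap _ (P1.Frac (ZMod p)) (b : MvPolynomial (Fin 2) (ZMod p)) ≠ 0 := by
    have : (b : MvPolynomial (Fin 2) (ZMod p)) ≠ 0 := fun h => hb ⟨x.1, hxW⟩ (h ▸ zero_mem _)
    simpa using this
  have ha' := aeval_dehomogenize (ZMod p) i a.2
  have hb' := aeval_dehomogenize (ZMod p) i b.2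
  have hs' : ∀ y : W', P1.eval W' y (Sec.res _ hW'V s) =
      algebraMap _ (P1.Frac (ZMod p)) (a : MvPolynomial (Fin 2) (ZMod p)) /
        algebraMap _ (P1.Frac (ZMod p)) (b : MvPolynomial (Fin 2) (ZMod p)) := fun y => by
    have h1 : P1.eval W' y (Sec.res _ hW'V s) = P1.toFrac y.1 (HomogeneousLocalization.mk
        ⟨d, a, b, hb ⟨y.1, y.2.1⟩⟩) := congrArg (P1.toFrac y.1) (hs ⟨y.1, y.2.1⟩)
    exact h1.trans (P1.toFrac_mk _ _)
  have key : Q.1 ⟨W', le_top⟩ (Sec.res _ hW'V s) = 0 := by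
    refine apply_eq_zero_of_comp_eq_zero φ (a := dehomogenize (ZMod p) i a)
      (b := dehomogenize (ZMod p) i b) (fun z hz => ?_) ?_ (n + 1) _ (hQ ⟨W', le_top⟩) fun f => ?_
    · refine P1.eval_injective _ _ fun y => ?_
      have h1 := congrArg (P1.eval W' y) hz
      rw [map_mul, hφ, map_zero] at h1
      refine (mul_eq_zero.mp h1).resolve_left fun h2 => hb0 ?_
      rw [← hb', h2, zero_mul]
    · refine sub_eq_zero.mp (P1.eval_injective _ _ fun y => ?_)
      rw [map_sub, map_mul, hφ, hφ, hs', sub_eq_zero, ← mul_div_assoc, div_eq_iff hb0]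
      refine mul_left_cancel₀ (pow_ne_zero d h0) ?_
      linear_combination (algebraMap _ (P1.Frac (ZMod p)) (a : MvPolynomial (Fin 2) (ZMod p))) * hb'
        - (algebraMap _ (P1.Frac (ZMod p)) (b : MvPolynomial (Fin 2) (ZMod p))) * ha'
    · have h1 := Q.2 ⟨W', le_top⟩ ⟨chart (ZMod p) i, le_top⟩ hW'i (chartSec (ZMod p) i f)
      rw [h, map_zero] at h1
      exact h1.symm
  -- Compatibility with restriction carries the vanishing on `W'` back to the value at `x` of `Q s`
  -- on `V`.
  have h2 := Q.2 ⟨W', le_top⟩ V hW'V s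
  rw [key] at h2
  have h3 := P1.eval_res hW'V ⟨x.1, hxW, hxi⟩ (Q.1 V s)
  rw [h2, map_zero] at h3
  exact h3.symm.trans (map_zero _).symm

/-- The image of `H` multiplies the powers of the coordinates by their weights. -/
theorem rho_elemH_coord_pow (i : Fin 2) (n : ℕ) :
    (rho p (elemH (ZMod p))).1 ⟨chart (ZMod p) i, le_top⟩ (coord (ZMod p) i ^ n) =
      (n * weightCoord (ZMod p) i) • coord (ZMod p) i ^ n := by
  refine sub_eq_zero.mp (P1.eval_injective _ _ fun x => ?_)
  have h1 : ∀ f, P1.eval (chart (ZMod p) i) x (chartSec (ZMod p) i f) =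
    aeval (fracCoord (ZMod p) i) f := eval_chartSec p i (chart (ZMod p) i) le_rfl x
  have h2 := h1 (X ^ n)
  have h3 := h1 (((n : ZMod p) * weightCoord (ZMod p) i) • X ^ n)
  rw [chartSec, map_pow, aeval_X, map_pow (aeval _), aeval_X] at h2
  rw [chartSec, map_smul (aeval (coord (ZMod p) i)), map_pow (aeval (coord (ZMod p) i)), aeval_X,
    map_smul (aeval (fracCoord (ZMod p) i)), map_pow (aeval (fracCoord (ZMod p) i)), aeval_X] at h3
  rw [map_sub, h3, sub_eq_zero]
  refine (rhoFun_spec p (elemH (ZMod p)) ⟨chart (ZMod p) i, le_top⟩ x _).trans ?_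
  rw [h2]
  exact extOp_distH_coord_pow (ZMod p) i n

/-- The weights are `-2` and `2`; the oddness of `p` enters here, and makes `n` times the weight
vanish only when `p ∣ n`. -/
theorem weightCoord_ne_zero (hp : 2 < p) (i : Fin 2) : weightCoord (ZMod p) i ≠ 0 := by
  have h2 : (2 : ZMod p) ≠ 0 := by
    intro h
    have : ((2 : ℕ) : ZMod p) = 0 := by exact_mod_cast h
    rw [ZMod.natCast_eq_zero_iff] at this
    exact absurd (Nat.le_of_dvd two_pos this) (by omega)
  fin_cases i
  · have : weightCoord (ZMod p) 0 = -2 := by simp [weightCoord, weightH]; norm_num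
    exact this ▸ neg_ne_zero.mpr h2
  · have : weightCoord (ZMod p) 1 = 2 := by simp [weightCoord, weightH]; norm_num
    exact this ▸ h2

/-- The image of `Δ_T` is the projector on the powers `t ^ n` with `p ∣ n`. -/
theorem rho_deltaT_coord_pow (hp : 2 < p) (i : Fin 2) (n : ℕ) :
    (rho p (deltaT p)).1 ⟨chart (ZMod p) i, le_top⟩ (coord (ZMod p) i ^ n) =
      (if (n : ZMod p) = 0 then (1 : ZMod p) else 0) • coord (ZMod p) i ^ n := by
  let ε := (sheafEndEval (P1.toSpec (ZMod p)) (U := ⊤) ⟨chart (ZMod p) i, le_top⟩).comp (rho p)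
  change ε (deltaT p) _ = _
  -- The power `t_i ^ n` is an eigenvector of `H`, so a polynomial in `H` acts on it by its value at
  -- the eigenvalue.
  have h1 : ∀ q : (ZMod p)[X], ε (aeval (elemH (ZMod p)) q) (coord (ZMod p) i ^ n) =
      q.eval (n * weightCoord (ZMod p) i) • coord (ZMod p) i ^ n := fun q => by
    rw [← aeval_algHom_apply]
    exact Module.End.aeval_apply_of_mem_apply_eq_smul (rho_elemH_coord_pow p i n)
  rw [deltaT, map_sum, LinearMap.sum_apply]
  simp only [binomH, map_smul, LinearMap.smul_apply, h1]
  simp only [smul_smul, ← Finset.sum_smul]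
  rw [sum_eval_descPochhammer]
  simp [weightCoord_ne_zero p hp i]

/-- The bound is computed after applying `ρ`: `deltaT_mem` places `Δ_T` only in order `≤ 2p - 2`,
whereas orders of operators on the projective line add exactly as needed. -/
theorem rho_deltaT_mem : rho p (deltaT p) ∈ diffOps (P1.toSpec (ZMod p)) (p - 1) ⊤ := by
  have hH : rho p (elemH (ZMod p)) ∈ diffOps (P1.toSpec (ZMod p)) 1 ⊤ :=
    rho_mem p 1 _ (SL2Ring.distH_mem (ZMod p))
  rw [deltaT, map_sum]
  refine Submodule.sum_mem _ fun i hi => ?_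
  rw [binomH, map_smul, map_smul, ← aeval_algHom_apply]
  refine Submodule.smul_mem _ _ (Submodule.smul_mem _ _ (aeval_mem_diffOps _ hH ?_))
  rw [descPochhammer_natDegree]
  have := Finset.mem_range.mp hi
  omega

theorem isDworkOperator_rho_deltaT (hp : 2 < p) : IsDworkOperator p (rho p (deltaT p)) := by
  rw [isDworkOperator_iff]
  intro i f
  have : p ≠ 0 := by omega
  induction f using Polynomial.induction_on' with
  | add f g hf hg =>
    have h1 : contract p (f + g) = contract p f + contract p g := by
      ext n
      simp [coeff_contract this]
    simp only [chartSec, map_add, h1] at hf hg ⊢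
    rw [hf, hg]
  | monomial n a =>
    have h1 : contract p (a • (X ^ n : (ZMod p)[X])) = a • contract p (X ^ n) := by
      ext n
      simp [coeff_contract this]
    rw [← smul_X_eq_monomial, h1]
    simp only [chartSec, map_smul, map_pow, aeval_X]
    rw [rho_deltaT_coord_pow p hp, expand_contract_X_pow]
    split_ifs <;> simp

/-- The Dwork operator in a chart. -/
theorem rho_deltaT_chartSec (hp : 2 < p) (i : Fin 2) (f : (ZMod p)[X]) :
    (rho p (deltaT p)).1 ⟨chart (ZMod p) i, le_top⟩ (chartSec (ZMod p) i f) =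
      ∑ r ∈ Finset.range p, (-coord (ZMod p) i) ^ r *
        chartSec (ZMod p) i (hasseDeriv r f) := by
  induction f using Polynomial.induction_on' with
  | add f g hf hg =>
    simp only [chartSec, map_add, mul_add, Finset.sum_add_distrib] at hf hg ⊢
    rw [hf, hg]
  | monomial n a =>
    -- The factor `t ^ r` restores the degree lowered by the divided derivative. For `r > n`, where
    -- `n - r` is truncated, the binomial coefficient vanishes.
    have h1 : ∀ r, (-coord (ZMod p) i) ^ r * chartSec (ZMod p) i (hasseDeriv r (monomial n a)) =
        ((-1) ^ r * (n.choose r : ZMod p)) • a • coord (ZMod p) i ^ n := fun r => by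
      rw [hasseDeriv_monomial, chartSec, aeval_monomial]
      rcases le_or_gt r n with h | h
      · obtain ⟨m, rfl⟩ := Nat.exists_eq_add_of_le h
        rw [Nat.add_sub_cancel_left, neg_pow, pow_add]
        simp only [Algebra.smul_def, map_mul, map_pow, map_neg, map_one, map_natCast]
        ring
      · simp [Nat.choose_eq_zero_of_lt h]
    simp only [h1]
    rw [← Finset.sum_smul, sum_choose_natCast, ← smul_X_eq_monomial]
    simp only [chartSec, map_smul, map_pow, aeval_X]
    rw [rho_deltaT_coord_pow p hp, smul_comm]

theorem eq_of_isDworkOperator {P P' : diffOps (P1.toSpec (ZMod p)) (p - 1) ⊤}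
    (h : IsDworkOperator p P.1) (h' : IsDworkOperator p P'.1) : P = P' := by
  rw [isDworkOperator_iff] at h h'
  refine Subtype.ext (sub_eq_zero.mp (eq_zero_of_chartSec_eq_zero p (sub_mem P.2 P'.2) ?_))
  intro i f
  exact sub_eq_zero.mpr ((h i f).trans (h' i f).symm)

end Projector

end ArithDiff

end

theorem proposition3p2p1 (p : ℕ) [Fact p.Prime] (hp : 2 < p) :
    (∃! P : diffOps (P1.toSpec (ZMod p)) (p - 1) ⊤, IsDworkOperator p P.1) ∧
    ∀ P : diffOps (P1.toSpec (ZMod p)) (p - 1) ⊤, IsDworkOperator p P.1 →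
      (∀ (i : Fin 2) (f : Polynomial (ZMod p)),
        P.1.1 ⟨chart (ZMod p) i, le_top⟩ (chartSec (ZMod p) i f) =
          ∑ r ∈ Finset.range p, (-coord (ZMod p) i) ^ r *
            chartSec (ZMod p) i (Polynomial.hasseDeriv r f)) ∧
      ∀ (m : ℕ) (hm : 0 < m), rhoLevel p m (deltaLevel p m hm) = opLevel p m hm P := by
  have h := isDworkOperator_rho_deltaT p hp
  refine ⟨⟨⟨rho p (deltaT p), rho_deltaT_mem p⟩, h, fun P hP => eq_of_isDworkOperator p hP h⟩,
    fun P hP => ?_⟩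
  -- By uniqueness, the remaining claims need only be checked for `ρ(Δ_T)` itself.
  obtain rfl := eq_of_isDworkOperator p hP (P' := ⟨rho p (deltaT p), rho_deltaT_mem p⟩) h
  refine ⟨rho_deltaT_chartSec p hp, fun m hm => ?_⟩
  rw [rhoLevel, AlgHom.comp_apply, deltaLevel, LevelAlg.map_of]
  -- Since `ρ_m` is induced by `ρ` on generators, both sides are the class of the same operator;
  -- only the proofs of the order bound differ.
  rfl
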